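/- Let $\mathcal X$ be a finite set, $x^*\in\mathcal X$, $l\in\mathbb N_0$ and $\alpha>0$. For each $\theta\in\mathbb R^l$ let $P_\theta$ be a (row-)stochastic matrix on $\mathcal X$ and $C_\theta:\mathcal X\to\mathbb R$ a cost function. Let $\mathbb E_x^\theta$ denote expectation for the Markov chain $(\Phi_i)_{i\ge 0}$ with transition matrix $P_\theta$ and $\Phi_0=x$, and let $\tau=\inf\{i\ge 1:\Phi_i=x^*\}$. Assume: (1) every matrix in the closure of $\{P_\theta:\theta\in\mathbb R^l\}$ (in the space of $\mathcal X\times\mathcal X$ real matrices) is irreducible and aperiodic; (2) for all $x,y\in\mathcal X$, the functions $\theta\mapsto P_\theta(x,y)$ and $\theta\mapsto C_\theta(x)$ are bounded and twice differentiable on $\mathbb R^l$ with bounded first and second derivatives. Then for every $\theta$ the limit $$\Lambda_\theta=\lim_{n\to\infty}\frac1n\ln\mathbb E_x^\theta\Big[\exp\Big(\alpha\sum_{i=0}^{n-1}C_\theta(\Phi_i)\Big)\Big]$$ exists and does not depend on $x\in\mathcal X$. For $\Lambda\in\mathbb R$ put $H(\theta,\Lambda)=\exp\big(\sum_{i=0}^{\tau-1}(\alpha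 C_\theta(\Phi_i)-\Lambda)\big)$. (a) Hard truncation. For every $M>1$ and $\theta$ the equation $\mathbb E_{x^*}^\theta[H(\theta,\Lambda)\wedge M]=1$ has exactly one root $\Lambda=\Lambda_\theta^{(M)}\in\mathbb R$. For every $\delta>0$ there is $M_\delta>1$ such that $0\le\Lambda_\theta-\Lambda_\theta^{(M)}<\delta$ for all $M\ge M_\delta$ (in particular for $M=M_\delta$) and all $\theta\in\mathbb R^l$. (b) Smooth truncation. For $M>1$ let $G^{(M)}(\theta,\Lambda)=H(\theta,\Lambda)$ if $H(\theta,\Lambda)\le M$ and $G^{(M)}(\theta,\Lambda)=M\sum_{i=0}^{4}\frac1{i!}\big(\ln(M^{-1}H(\theta,\Lambda))\big)^i$ if $H(\theta,\Lambda)>M$. For every $M>1$ and $\theta$ the equation $\mathbb E_{x^*}^\theta[G^{(M)}(\theta,\Lambda)]=1$ has exactly one root $\Lambda=\widetilde\Lambda_\theta^{(M)}\in\mathbb R$. For each $\theta$ the map $M\mapsto\widetilde\Lambda_\theta^{(M)}$ is nondecreasing on $(1,\infty)$ and bounded above by $\Lambda_\theta$, and $\widetilde\Lambda_\theta^{(M)}\to\Lambda_\theta$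 as $M\to\infty$, uniformly over $\theta\in\mathbb R^l$. -/

import Mathlib

open MeasureTheory ProbabilityTheory Filter Topology Matrix
open scoped ENNReal

namespace RiskSensitive

/-- A finite Markov chain is aperiodic: at every state, the greatest common divisor of the possible
return times is `1`. -/
def IsAperiodic {X : Type*} [Fintype X] [DecidableEq X] (Q : Matrix X X ℝ) : Prop :=
  ∀ (x : X) (d : ℕ), (∀ n : ℕ, 1 ≤ n → 0 < (Q ^ n) x x → d ∣ n) → d = 1

/-- `f` is bounded and twice differentiable, with bounded first and second derivatives. -/
def IsBoundedTwiceDiff {l : ℕ} (f : EuclideanSpace ℝ (Fin l) → ℝ) : Prop :=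
  Differentiable ℝ f ∧ Differentiable ℝ (fderiv ℝ f) ∧
    (∃ K : ℝ, ∀ θ, |f θ| ≤ K) ∧ (∃ K : ℝ, ∀ θ, ‖fderiv ℝ f θ‖ ≤ K) ∧
    (∃ K : ℝ, ∀ θ, ‖fderiv ℝ (fderiv ℝ f) θ‖ ≤ K)

section Chain

variable {X : Type*} [Fintype X] [DecidableEq X] [MeasurableSpace X] [MeasurableSingletonClass X]

/-- The distribution `P(x, ·)` of the next state, given the current state `x`. -/
noncomputable def nextState (P : rowStochastic ℝ X) (x : X) : PMF X :=
  PMF.ofFintype (fun y => ENNReal.ofReal ((P : Matrix X X ℝ) x y)) (by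
    rw [← ENNReal.ofReal_sum_of_nonneg fun y _ => P.2.1 x y,
      sum_row_of_mem_rowStochastic P.2 x, ENNReal.ofReal_one])

/-- The transition kernel at time `n`: given the history `Φ_0, …, Φ_n`, the next state has
distribution `P(Φ_n, ·)`. -/
noncomputable def stepKernel (P : rowStochastic ℝ X) (n : ℕ) :
    Kernel ((i : Finset.Iic n) → (fun _ : ℕ => X) i) ((fun _ : ℕ => X) (n + 1)) :=
  Kernel.ofFunOfCountable fun h => (nextState P (h ⟨n, Finset.mem_Iic.2 le_rfl⟩)).toMeasure

instance (P : rowStochastic ℝ X) (n : ℕ) : IsMarkovKernel (stepKernel P n) :=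
  ⟨fun h => inferInstanceAs
    (IsProbabilityMeasure (nextState P (h ⟨n, Finset.mem_Iic.2 le_rfl⟩)).toMeasure)⟩

/-- The law, on the space `ℕ → X` of trajectories, of the Markov chain `(Φ_i)_{i ≥ 0}` with
transition matrix `P` started at `Φ_0 = x`. -/
noncomputable def chainLaw (P : rowStochastic ℝ X) (x : X) : Measure (ℕ → X) :=
  Kernel.traj (X := fun _ : ℕ => X) (stepKernel P) 0 fun _ => x

/-- `(1/n) log E_x[exp(α ∑_{i<n} C(Φ_i))]`. -/
noncomputable def finiteHorizonCost (P : rowStochastic ℝ X) (C : X → ℝ) (α : ℝ) (x : X) (n : ℕ) :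
    ℝ :=
  (1 / (n : ℝ)) *
    Real.log (∫ ω, Real.exp (α * ∑ i ∈ Finset.range n, C (ω i)) ∂(chainLaw P x))

/-- The risk-sensitive cost `Λ = lim_n (1/n) log E_{x}[exp(α ∑_{i<n} C(Φ_i))]`. The existence of the
limit is not part of this definition. -/
noncomputable def riskCost (P : rowStochastic ℝ X) (C : X → ℝ) (α : ℝ) (x : X) : ℝ :=
  limUnder atTop (finiteHorizonCost P C α x)

/-- The first return time `τ = inf {i ≥ 1 : Φ_i = xs}` to the state `xs`. (It is set to `0` on
trajectories that never return; for an irreducible finite chain these form a null set.) -/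
noncomputable def returnTime (xs : X) (ω : ℕ → X) : ℕ :=
  sInf {i : ℕ | 1 ≤ i ∧ ω i = xs}

/-- `H(Λ) = exp(∑_{i<τ} (α C(Φ_i) - Λ))`. -/
noncomputable def excursionWeight (C : X → ℝ) (α : ℝ) (xs : X) (Λ : ℝ) (ω : ℕ → X) : ℝ :=
  Real.exp (∑ i ∈ Finset.range (returnTime xs ω), (α * C (ω i) - Λ))

/-- The smooth truncation of a number `h > 0` at level `M`: `h` itself if `h ≤ M`, and
`M ∑_{i=0}^{4} (log (h / M))^i / i!` if `h > M`. -/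
noncomputable def smoothTrunc (M h : ℝ) : ℝ :=
  if h ≤ M then h
  else M * ∑ i ∈ Finset.range 5, (1 / (Nat.factorial i : ℝ)) * Real.log (M⁻¹ * h) ^ i

/-- `g^{(M)}(Λ) = E_{xs}[H(Λ) ∧ M]`. -/
noncomputable def gHard (P : rowStochastic ℝ X) (C : X → ℝ) (α : ℝ) (xs : X) (M Λ : ℝ) : ℝ≥0∞ :=
  ∫⁻ ω, ENNReal.ofReal (min (excursionWeight C α xs Λ ω) M) ∂(chainLaw P xs)

/-- `g^{(M)}(Λ) = E_{xs}[G^{(M)}(Λ)]`, where `G^{(M)}(Λ)` is the smooth truncation of `H(Λ)`. -/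
noncomputable def gSmooth (P : rowStochastic ℝ X) (C : X → ℝ) (α : ℝ) (xs : X) (M Λ : ℝ) : ℝ≥0∞ :=
  ∫⁻ ω, ENNReal.ofReal (smoothTrunc M (excursionWeight C α xs Λ ω)) ∂(chainLaw P xs)

/-- The root `Λ^{(M)}` of `g^{(M)}(Λ) = 1` for the hard truncation. Existence and uniqueness of the
root are not part of this definition. -/
noncomputable def hardCost (P : rowStochastic ℝ X) (C : X → ℝ) (α : ℝ) (xs : X) (M : ℝ) : ℝ :=
  Classical.epsilon fun Λ => gHard P C α xs M Λ = 1

/-- The root `Λ^{(M)}` of `g^{(M)}(Λ) = 1` for the smooth truncation. Existence and uniqueness of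
the root are not part of this definition. -/
noncomputable def smoothCost (P : rowStochastic ℝ X) (C : X → ℝ) (α : ℝ) (xs : X) (M : ℝ) : ℝ :=
  Classical.epsilon fun Λ => gSmooth P C α xs M Λ = 1

end Chain

end RiskSensitive

/-!
Write `H(Λ)` for the excursion weight, `τ` for the return time to `xs`, and `A` for the matrix with
entries `exp (α C(x) - Λ) P(x,y)` (`tilted`).

*The exponent.* The tilted matrix with `Λ = 0` is nonnegative and irreducible, so it has a positive
eigenvector `v` with an eigenvalue `ρ > 0` (`exists_pos_eigenvector`). By the Feynman–Kac formula
(`lintegral_prod_mul`) the expectation of `exp (α ∑_{i<n} C(Φ_i))` is the `n`-th power of that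
matrix applied to the constant `1`; it lies between two multiples of `ρ ^ n`, whatever the initial
state, so that the limit is `Λ₀ = log ρ`.

*The equation for `Λ₀`.* For `Λ = Λ₀` one has `A v = v`. Let `T` be `A` killed on entering `xs`
(`taboo`), and `w n = (T ^ n v)(xs) / v(xs)`. Then `E[H(Λ₀); τ = n + 1] = w n - w (n + 1)`
(`setLIntegral_excursionWeight_eq_sub`), and `w n` decays geometrically (`taboo_pow_mulVec_le`);
hence `E[H(Λ₀)] = 1`. The same computation with zero cost, where `A = P` and `v = 1`, shows that
`τ` is almost surely finite and has a finite fourth moment.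

*Truncation.* Both truncations are continuous monotone functions `t` with
`min h M ≤ t h ≤ h` and polynomial growth in `log h` (`IsTruncation`). For each of them
`Λ ↦ E[t(H(Λ))]` is finite, continuous and nonincreasing, at least `M > 1` for very negative `Λ`,
and at most `E[H(Λ₀)] = 1` at `Λ₀`; it cannot take the value `1` twice. So it has exactly one root,
which is at most `Λ₀` (`existsUnique_truncMean_eq_one`).

*Uniformity.* The transition matrices lie in a compact set of irreducible matrices, on which
irreducibility is quantitatively uniform (`exists_uniform_pow_le`); the costs are uniformly bounded.
So the rate of decay of `w` is uniform in `θ`. As `τ ≥ 1`, lowering `Λ₀` by `δ` multiplies `H` by at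
least `exp δ`, and the excursions of length at most `n`, on which the truncation at a large level is
not felt, contribute at least `exp δ * (1 - w n) > 1` to `E[t(H(Λ₀ - δ))]`
(`one_lt_truncMean_sub`). Hence the root exceeds `Λ₀ - δ`, for all `θ` at once.
-/

namespace RiskSensitive

/-! ### Truncation functions -/

/-- `t` truncates positive numbers at level `M`: it is continuous and nondecreasing, lies between
the hard truncation `min h M` and the identity (so that `t h = h` for `h ≤ M`), and grows at most
like the fourth power of `log h`. The last condition makes the truncated excursion weight integrable
for every `Λ`, although `H(Λ)` itself need not be. Values of `t` at nonpositive numbers play no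
role. -/
structure IsTruncation (M : ℝ) (t : ℝ → ℝ) : Prop where
  continuousOn : ContinuousOn t (Set.Ioi 0)
  monotoneOn : MonotoneOn t (Set.Ioi 0)
  min_le : ∀ h, 0 < h → min h M ≤ t h
  le_self : ∀ h, 0 < h → t h ≤ h
  exists_le_pow_log : ∃ D : ℝ, ∀ h, 0 < h → t h ≤ D * (1 + |Real.log h|) ^ 4

lemma IsTruncation.nonneg {M : ℝ} {t : ℝ → ℝ} (ht : IsTruncation M t) (hM : 0 < M) {h : ℝ}
    (hh : 0 < h) : 0 ≤ t h :=
  (le_min hh.le hM.le).trans (ht.min_le h hh)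

lemma isTruncation_min {M : ℝ} (hM : 0 < M) : IsTruncation M (fun h => min h M) where
  continuousOn := by fun_prop
  monotoneOn := fun a _ b _ hab => min_le_min_right M hab
  min_le := fun _ _ => le_rfl
  le_self := fun _ _ => min_le_left _ _
  exists_le_pow_log := ⟨M, fun h _ => (min_le_right _ _).trans
    (le_mul_of_one_le_right hM.le (one_le_pow₀ (by linarith [abs_nonneg (Real.log h)])))⟩

/-- The fourth Taylor polynomial of the exponential function at `0`. -/
noncomputable def expTaylor (u : ℝ) : ℝ :=
  ∑ i ∈ Finset.range 5, (1 / (Nat.factorial i : ℝ)) * u ^ i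

lemma expTaylor_eq (u : ℝ) : expTaylor u = 1 + u + u ^ 2 / 2 + u ^ 3 / 6 + u ^ 4 / 24 := by
  simp [expTaylor, Finset.sum_range_succ, Nat.factorial]
  ring

lemma expTaylor_zero : expTaylor 0 = 1 := by simp [expTaylor_eq]

lemma continuous_expTaylor : Continuous expTaylor := by
  unfold expTaylor; fun_prop

lemma expTaylor_mono {a b : ℝ} (ha : 0 ≤ a) (hab : a ≤ b) : expTaylor a ≤ expTaylor b := by
  unfold expTaylor
  gcongr

lemma one_le_expTaylor {u : ℝ} (hu : 0 ≤ u) : 1 ≤ expTaylor u :=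
  expTaylor_zero ▸ expTaylor_mono le_rfl hu

lemma expTaylor_le_exp {u : ℝ} (hu : 0 ≤ u) : expTaylor u ≤ Real.exp u := by
  refine le_of_eq_of_le ?_ (Real.sum_le_exp_of_nonneg hu 5)
  exact Finset.sum_congr rfl fun i _ => by ring

lemma expTaylor_le_pow {u : ℝ} (hu : 0 ≤ u) : expTaylor u ≤ (1 + u) ^ 4 := by
  have : (1 + u) ^ 4 - expTaylor u = 3 * u + 11 / 2 * u ^ 2 + 23 / 6 * u ^ 3 + 23 / 24 * u ^ 4 := by
    rw [expTaylor_eq]; ring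
  have : 0 ≤ (1 + u) ^ 4 - expTaylor u := by rw [this]; positivity
  linarith

/-- Every monomial of `expTaylor (a + b)` occurs in the product, by the binomial theorem. -/
lemma expTaylor_add_le {a b : ℝ} (ha : 0 ≤ a) (hb : 0 ≤ b) :
    expTaylor (a + b) ≤ expTaylor a * expTaylor b := by
  have h : expTaylor a * expTaylor b - expTaylor (a + b) =
      a * (b ^ 4 / 24) + a ^ 2 / 2 * (b ^ 3 / 6 + b ^ 4 / 24)
        + a ^ 3 / 6 * (b ^ 2 / 2 + b ^ 3 / 6 + b ^ 4 / 24)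
        + a ^ 4 / 24 * (b + b ^ 2 / 2 + b ^ 3 / 6 + b ^ 4 / 24) := by
    simp only [expTaylor_eq]; ring
  have : 0 ≤ expTaylor a * expTaylor b - expTaylor (a + b) := by rw [h]; positivity
  linarith

/-- Writing the smooth truncation as a product of two monotone continuous factors, so that no case
distinction at `h = M` is needed. -/
lemma smoothTrunc_eq {M h : ℝ} (hM : 0 < M) (hh : 0 < h) :
    smoothTrunc M h = min h M * expTaylor (max 0 (Real.log (M⁻¹ * h))) := by
  unfold smoothTrunc
  split_ifs with hle
  · rw [min_eq_left hle, max_eq_left, expTaylor_zero, mul_one]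
    refine Real.log_nonpos (by positivity) ?_
    rw [inv_mul_le_iff₀ hM]; linarith
  · rw [min_eq_right (le_of_not_ge hle), max_eq_right, expTaylor]
    refine Real.log_nonneg ?_
    rw [le_inv_mul_iff₀ hM]; linarith

lemma isTruncation_smoothTrunc {M : ℝ} (hM : 0 < M) : IsTruncation M (smoothTrunc M) where
  continuousOn := by
    refine ContinuousOn.congr (f := fun h =>
      min h M * expTaylor (max 0 (Real.log (M⁻¹ * h)))) ?_ fun h hh => smoothTrunc_eq hM hh
    refine ContinuousOn.mul (by fun_prop) (continuous_expTaylor.comp_continuousOn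
      (continuousOn_const.sup (ContinuousOn.log (by fun_prop) fun h hh => ?_)))
    exact (mul_pos (inv_pos.2 hM) hh).ne'
  monotoneOn := by
    intro a ha b hb hab
    have ha' : 0 < a := ha
    rw [smoothTrunc_eq hM ha, smoothTrunc_eq hM hb]
    refine mul_le_mul (min_le_min_right M hab) (expTaylor_mono (le_max_left _ _) ?_) ?_ ?_
    · refine max_le_max le_rfl (Real.log_le_log (by positivity) ?_)
      gcongr
    · exact zero_le_one.trans (one_le_expTaylor (le_max_left _ _))
    · exact le_min hb.le hM.le
  min_le := fun h hh => by
    rw [smoothTrunc_eq hM hh]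
    exact le_mul_of_one_le_right (le_min hh.le hM.le) (one_le_expTaylor (le_max_left _ _))
  le_self := fun h hh => by
    rcases le_or_gt h M with hle | hlt
    · exact (if_pos hle).le
    · have hu : 0 ≤ Real.log (M⁻¹ * h) := by
        refine Real.log_nonneg ?_
        rw [le_inv_mul_iff₀ hM]; linarith
      rw [smoothTrunc_eq hM hh, min_eq_right hlt.le, max_eq_right hu]
      calc M * expTaylor (Real.log (M⁻¹ * h)) ≤ M * (M⁻¹ * h) := by
            gcongr
            exact (expTaylor_le_exp hu).trans (Real.exp_log (by positivity)).le
        _ = h := by field_simp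
  exists_le_pow_log := by
    refine ⟨M * (1 + |Real.log M|) ^ 4, fun h hh => ?_⟩
    rw [smoothTrunc_eq hM hh, mul_assoc, ← mul_pow]
    refine mul_le_mul (min_le_right _ _) ((expTaylor_le_pow (le_max_left _ _)).trans ?_)
      (zero_le_one.trans (one_le_expTaylor (le_max_left _ _))) hM.le
    have hlog : max 0 (Real.log (M⁻¹ * h)) ≤ |Real.log M| + |Real.log h| := by
      rw [Real.log_mul (inv_pos.2 hM).ne' hh.ne', Real.log_inv]
      exact max_le (by positivity)
        (add_le_add (neg_le_abs _) (le_abs_self _))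
    have h0 : 0 ≤ max 0 (Real.log (M⁻¹ * h)) := le_max_left _ _
    gcongr
    nlinarith [mul_nonneg (abs_nonneg (Real.log M)) (abs_nonneg (Real.log h))]

/-- The smooth truncation increases with the level: this is
`expTaylor (a + b) ≤ exp a * expTaylor b` with `a = log (M₂ / M₁)` and `b = log (h / M₂)`. -/
lemma smoothTrunc_mono_level {M₁ M₂ h : ℝ} (hM₁ : 0 < M₁) (hM : M₁ ≤ M₂) (hh : 0 < h) :
    smoothTrunc M₁ h ≤ smoothTrunc M₂ h := by
  have hM₂ : 0 < M₂ := hM₁.trans_le hM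
  rcases le_or_gt h M₂ with hle | hlt
  · exact ((isTruncation_smoothTrunc hM₁).le_self h hh).trans (if_pos hle).ge
  · have hb : 0 ≤ Real.log (M₂⁻¹ * h) := by
      refine Real.log_nonneg ?_
      rw [le_inv_mul_iff₀ hM₂]; linarith
    have ha : 0 ≤ Real.log (M₁⁻¹ * M₂) := by
      refine Real.log_nonneg ?_
      rw [le_inv_mul_iff₀ hM₁]; linarith
    have hab : Real.log (M₁⁻¹ * h) = Real.log (M₁⁻¹ * M₂) + Real.log (M₂⁻¹ * h) := by
      rw [← Real.log_mul (by positivity) (by positivity)]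
      congr 1
      field_simp
    rw [smoothTrunc_eq hM₁ hh, smoothTrunc_eq hM₂ hh, min_eq_right (hM.trans hlt.le),
      min_eq_right hlt.le, hab, max_eq_right (add_nonneg ha hb), max_eq_right hb]
    calc M₁ * expTaylor (Real.log (M₁⁻¹ * M₂) + Real.log (M₂⁻¹ * h))
        ≤ M₁ * ((M₁⁻¹ * M₂) * expTaylor (Real.log (M₂⁻¹ * h))) := by
          gcongr
          refine (expTaylor_add_le ha hb).trans ?_
          refine mul_le_mul_of_nonneg_right ?_ (zero_le_one.trans (one_le_expTaylor hb))
          exact (expTaylor_le_exp ha).trans (Real.exp_log (by positivity)).le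
      _ = M₂ * expTaylor (Real.log (M₂⁻¹ * h)) := by field_simp

/-! ### The Feynman–Kac formula and excursions of the chain -/

/-- Only positive values are characterised: trajectories that never return have `τ = 0`. -/
lemma returnTime_eq_succ_iff {X : Type*} (xs : X) (ω : ℕ → X) (n : ℕ) :
    returnTime xs ω = n + 1 ↔ (∀ i < n, ω (i + 1) ≠ xs) ∧ ω (n + 1) = xs := by
  constructor
  · intro h
    have hne : {i : ℕ | 1 ≤ i ∧ ω i = xs}.Nonempty := by
      by_contra hc
      rw [Set.not_nonempty_iff_eq_empty] at hc
      simp [returnTime, hc] at h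
    have hmem := Nat.sInf_mem hne
    change returnTime xs ω ∈ _ at hmem
    rw [h] at hmem
    refine ⟨fun i hi hx => ?_, hmem.2⟩
    have : returnTime xs ω ≤ i + 1 := Nat.sInf_le ⟨Nat.le_add_left 1 i, hx⟩
    omega
  · rintro ⟨h1, h2⟩
    refine le_antisymm (Nat.sInf_le ⟨Nat.le_add_left 1 n, h2⟩) ?_
    refine le_csInf ⟨n + 1, Nat.le_add_left 1 n, h2⟩ ?_
    rintro j ⟨hj1, hj2⟩
    by_contra hlt
    exact h1 (j - 1) (by omega) (by rwa [Nat.sub_add_cancel hj1])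

lemma measurable_returnTime {X : Type*} [MeasurableSpace X] [MeasurableSingletonClass X]
    (xs : X) : Measurable (returnTime xs : (ℕ → X) → ℕ) := by
  have hsucc : ∀ n, MeasurableSet ((returnTime xs : (ℕ → X) → ℕ) ⁻¹' {n + 1}) := fun n => by
    have : (returnTime xs : (ℕ → X) → ℕ) ⁻¹' {n + 1} =
        (⋂ i ∈ Finset.range n, (fun ω : ℕ → X => ω (i + 1)) ⁻¹' {xs}ᶜ) ∩
          (fun ω : ℕ → X => ω (n + 1)) ⁻¹' {xs} := by
      ext ω
      simp [returnTime_eq_succ_iff]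
    rw [this]
    refine MeasurableSet.inter (Finset.measurableSet_biInter _ fun i _ => ?_) ?_
    · exact measurable_pi_apply (i + 1) (measurableSet_singleton xs).compl
    · exact measurable_pi_apply (n + 1) (measurableSet_singleton xs)
  refine measurable_to_countable' fun n => ?_
  cases n with
  | zero =>
    have : (returnTime xs : (ℕ → X) → ℕ) ⁻¹' {0} =
        (⋃ n, (returnTime xs : (ℕ → X) → ℕ) ⁻¹' {n + 1})ᶜ := by
      ext ω
      simp only [Set.mem_preimage, Set.mem_singleton_iff, Set.mem_compl_iff, Set.mem_iUnion,
        not_exists]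
      exact ⟨fun h n => by omega, fun h => by
        by_contra h0
        exact h _ (Nat.succ_pred_eq_of_ne_zero h0).symm⟩
    rw [this]
    exact (MeasurableSet.iUnion hsucc).compl
  | succ n => exact hsucc n

lemma measurable_excursionWeight {X : Type*} [Countable X] [MeasurableSpace X]
    [MeasurableSingletonClass X] (C : X → ℝ) (α : ℝ) (xs : X) (Λ : ℝ) :
    Measurable (excursionWeight C α xs Λ) := by
  have h : Measurable fun p : ℕ × (ℕ → X) => ∑ i ∈ Finset.range p.1, (α * C (p.2 i) - Λ) := by
    refine measurable_from_prod_countable_right fun n => ?_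
    change Measurable fun ω : ℕ → X => ∑ i ∈ Finset.range n, (α * C (ω i) - Λ)
    refine Finset.measurable_fun_sum _ fun i _ => ?_
    exact (measurable_of_countable fun x => α * C x - Λ).comp (measurable_pi_apply i)
  exact Real.measurable_exp.comp (h.comp ((measurable_returnTime xs).prodMk measurable_id))

section Law

variable {X : Type*} [Fintype X] [DecidableEq X] [MeasurableSpace X] [MeasurableSingletonClass X]

instance isProbabilityMeasure_chainLaw (P : rowStochastic ℝ X) (x : X) :
    IsProbabilityMeasure (chainLaw P x) := by
  unfold chainLaw; infer_instance

lemma lintegral_nextState (P : rowStochastic ℝ X) (x : X) (f : X → ℝ≥0∞) :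
    ∫⁻ y, f y ∂(nextState P x).toMeasure =
      ∑ y, ENNReal.ofReal ((P : Matrix X X ℝ) x y) * f y := by
  rw [lintegral_fintype]
  refine Finset.sum_congr rfl fun y _ => ?_
  rw [PMF.toMeasure_apply_singleton _ _ (measurableSet_singleton y), mul_comm]
  rfl

lemma lintegral_chainLaw_zero (P : rowStochastic ℝ X) (x : X) (f : X → ℝ≥0∞) :
    ∫⁻ ω, f (ω 0) ∂chainLaw P x = f x := by
  have h : ∫⁻ ω, f (ω 0) ∂chainLaw P x =
      ∫⁻ h, f (h ⟨0, Finset.mem_Iic.2 le_rfl⟩)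
        ∂((chainLaw P x).map (Preorder.frestrictLe (π := fun _ => X) 0)) := by
    rw [lintegral_map (by exact measurable_of_countable _) (by fun_prop)]
    rfl
  rw [h, chainLaw, Kernel.traj_map_frestrictLe_apply, Kernel.partialTraj_self, Kernel.id_apply,
    lintegral_dirac' _ (by exact measurable_of_countable _)]

/-- The Markov property at time `n`, for a factor `F` that depends on `Φ_0, …, Φ_n` only. -/
lemma lintegral_chainLaw_step (P : rowStochastic ℝ X) (x : X) (n : ℕ) (F : (ℕ → X) → ℝ≥0∞)
    (hF : ∀ ω, F (fun i => ω (min i n)) = F ω) (L : X → X → ℝ≥0∞) :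
    ∫⁻ ω, F ω * L (ω n) (ω (n + 1)) ∂chainLaw P x =
      ∫⁻ ω, F ω * ∑ y, ENNReal.ofReal ((P : Matrix X X ℝ) (ω n) y) * L (ω n) y
        ∂chainLaw P x := by
  -- `e` turns a history into a trajectory, frozen at time `n`
  let e : ((i : Finset.Iic n) → X) → ℕ → X :=
    fun h i => h ⟨min i n, Finset.mem_Iic.2 (min_le_right i n)⟩
  have he : ∀ ω : ℕ → X, F (e (Preorder.frestrictLe (π := fun _ => X) n ω)) = F ω := hF
  have hen : ∀ ω : ℕ → X, e (Preorder.frestrictLe (π := fun _ => X) n ω) n = ω n := fun ω => by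
    simp [e]
  have h1 : ∫⁻ ω, F ω * L (ω n) (ω (n + 1)) ∂chainLaw P x =
      ∫⁻ p, F (e p.1) * L (e p.1 n) p.2
        ∂((chainLaw P x).map
          (fun ω => (Preorder.frestrictLe (π := fun _ => X) n ω, ω (n + 1)))) := by
    rw [lintegral_map (by exact measurable_of_countable _) (by fun_prop)]
    simp only [he, hen]
  have h2 : ∫⁻ ω, F ω * ∑ y, ENNReal.ofReal ((P : Matrix X X ℝ) (ω n) y) * L (ω n) y
        ∂chainLaw P x =
      ∫⁻ h, F (e h) * ∑ y, ENNReal.ofReal ((P : Matrix X X ℝ) (e h n) y) * L (e h n) y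
        ∂((chainLaw P x).map (Preorder.frestrictLe (π := fun _ => X) n)) := by
    rw [lintegral_map (by exact measurable_of_countable _) (by fun_prop)]
    simp only [he, hen]
  rw [h1, h2, chainLaw, ← Kernel.partialTraj_compProd_eq_map_traj (Nat.zero_le n),
    Kernel.traj_map_frestrictLe_apply,
    Measure.lintegral_compProd (by exact measurable_of_countable _)]
  refine lintegral_congr fun h => ?_
  change ∫⁻ b, F (e h) * L (e h n) b ∂_ = _
  rw [lintegral_const_mul _ (by exact measurable_of_countable _)]
  congr 1
  rw [← lintegral_nextState]
  have : e h n = h ⟨n, Finset.mem_Iic.2 le_rfl⟩ := by simp [e]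
  rw [this]
  rfl

/-- The Feynman–Kac formula: multiplicative functionals of the chain are integrated by powers of
the weighted transition matrix. -/
lemma lintegral_prod_mul (P : rowStochastic ℝ X) (x : X) {K : X → X → ℝ}
    (hK : ∀ x y, 0 ≤ K x y) (n : ℕ) {u : X → ℝ} (hu : ∀ x, 0 ≤ u x) :
    ∫⁻ ω, ENNReal.ofReal ((∏ i ∈ Finset.range n, K (ω i) (ω (i + 1))) * u (ω n)) ∂chainLaw P x =
      ENNReal.ofReal (((Matrix.of fun x y => (P : Matrix X X ℝ) x y * K x y) ^ n *ᵥ u) x) := by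
  induction n generalizing u with
  | zero => simpa using lintegral_chainLaw_zero P x fun y => ENNReal.ofReal (u y)
  | succ n ih =>
    set B : Matrix X X ℝ := Matrix.of fun x y => (P : Matrix X X ℝ) x y * K x y with hB
    have hBu : ∀ y, 0 ≤ (B *ᵥ u) y := fun y =>
      Finset.sum_nonneg fun z _ => mul_nonneg (mul_nonneg (P.2.1 y z) (hK y z)) (hu z)
    have hprod : ∀ ω : ℕ → X, 0 ≤ ∏ i ∈ Finset.range n, K (ω i) (ω (i + 1)) := fun ω =>
      Finset.prod_nonneg fun i _ => hK _ _
    rw [pow_succ, ← Matrix.mulVec_mulVec, ← ih hBu]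
    have := lintegral_chainLaw_step P x n
      (fun ω => ENNReal.ofReal (∏ i ∈ Finset.range n, K (ω i) (ω (i + 1)))) (fun ω => ?_)
      (fun y z => ENNReal.ofReal (K y z * u z))
    · convert this using 3 with ω ω
      · rw [Finset.prod_range_succ, mul_assoc, ENNReal.ofReal_mul (hprod ω)]
      · rw [ENNReal.ofReal_mul (hprod ω)]
        congr 1
        have hBz : ∀ z, 0 ≤ B (ω n) z * u z := fun z =>
          mul_nonneg (mul_nonneg (P.2.1 _ z) (hK _ z)) (hu z)
        rw [Matrix.mulVec, dotProduct, ENNReal.ofReal_sum_of_nonneg fun z _ => hBz z]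
        refine Finset.sum_congr rfl fun z _ => ?_
        rw [← ENNReal.ofReal_mul (P.2.1 _ z), hB, Matrix.of_apply, mul_assoc]
    · congr 1
      refine Finset.prod_congr rfl fun i hi => ?_
      have hi := Finset.mem_range.1 hi
      change K (ω (min i n)) (ω (min (i + 1) n)) = _
      rw [min_eq_left hi.le, min_eq_left (Nat.succ_le_of_lt hi)]

/-- The Feynman–Kac formula with a last factor that depends on the last transition. -/
lemma lintegral_prod_mul_last (P : rowStochastic ℝ X) (x : X) {K L : X → X → ℝ}
    (hK : ∀ x y, 0 ≤ K x y) (hL : ∀ x y, 0 ≤ L x y) (n : ℕ) :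
    ∫⁻ ω, ENNReal.ofReal ((∏ i ∈ Finset.range n, K (ω i) (ω (i + 1))) * L (ω n) (ω (n + 1)))
        ∂chainLaw P x =
      ENNReal.ofReal (((Matrix.of fun x y => (P : Matrix X X ℝ) x y * K x y) ^ n *ᵥ
        fun y => ∑ z, (P : Matrix X X ℝ) y z * L y z) x) := by
  have hprod : ∀ ω : ℕ → X, 0 ≤ ∏ i ∈ Finset.range n, K (ω i) (ω (i + 1)) := fun ω =>
    Finset.prod_nonneg fun i _ => hK _ _
  rw [← lintegral_prod_mul P x hK n fun y =>
    Finset.sum_nonneg fun z _ => mul_nonneg (P.2.1 y z) (hL y z)]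
  have := lintegral_chainLaw_step P x n
    (fun ω => ENNReal.ofReal (∏ i ∈ Finset.range n, K (ω i) (ω (i + 1)))) (fun ω => ?_)
    (fun y z => ENNReal.ofReal (L y z))
  · convert this using 3 with ω ω
    · rw [ENNReal.ofReal_mul (hprod ω)]
    · rw [ENNReal.ofReal_mul (hprod ω)]
      congr 1
      rw [ENNReal.ofReal_sum_of_nonneg fun z _ => mul_nonneg (P.2.1 _ z) (hL _ z)]
      exact Finset.sum_congr rfl fun z _ => ENNReal.ofReal_mul (P.2.1 _ z)
  · congr 1
    refine Finset.prod_congr rfl fun i hi => ?_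
    have hi := Finset.mem_range.1 hi
    change K (ω (min i n)) (ω (min (i + 1) n)) = _
    rw [min_eq_left hi.le, min_eq_left (Nat.succ_le_of_lt hi)]

/-- The matrix with entries `exp (α C(x) - Λ) P(x,y)`. -/
noncomputable def tilted (P : Matrix X X ℝ) (C : X → ℝ) (α Λ : ℝ) : Matrix X X ℝ :=
  Matrix.of fun x y => Real.exp (α * C x - Λ) * P x y

/-- The matrix `A` killed on entering `xs`: its column `xs` is replaced by `0`. -/
def taboo (A : Matrix X X ℝ) (xs : X) : Matrix X X ℝ :=
  Matrix.of fun x y => if y = xs then 0 else A x y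

/-- The contribution `E[H(Λ); τ = n + 1]` of the excursions of length `n + 1`. -/
lemma setLIntegral_excursionWeight (P : rowStochastic ℝ X) (C : X → ℝ) (α : ℝ) (xs : X) (Λ : ℝ)
    (n : ℕ) :
    ∫⁻ ω in {ω | returnTime xs ω = n + 1}, ENNReal.ofReal (excursionWeight C α xs Λ ω)
        ∂chainLaw P xs =
      ENNReal.ofReal ((taboo (tilted (P : Matrix X X ℝ) C α Λ) xs ^ n *ᵥ
        fun y => tilted (P : Matrix X X ℝ) C α Λ y xs) xs) := by
  have hms : MeasurableSet {ω : ℕ → X | returnTime xs ω = n + 1} :=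
    measurable_returnTime xs (measurableSet_singleton (n + 1))
  have key := lintegral_prod_mul_last P xs
    (K := fun x y => if y = xs then 0 else Real.exp (α * C x - Λ))
    (L := fun x y => if y = xs then Real.exp (α * C x - Λ) else 0)
    (fun x y => by split_ifs <;> positivity) (fun x y => by split_ifs <;> positivity) n
  rw [← lintegral_indicator hms]
  convert key using 2
  · ext ω
    by_cases h : returnTime xs ω = n + 1
    · rw [Set.indicator_of_mem (by exact h)]
      obtain ⟨h1, h2⟩ := (returnTime_eq_succ_iff xs ω n).1 h
      rw [if_pos h2, excursionWeight, h, Real.exp_sum, Finset.prod_range_succ]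
      congr 2
      exact Finset.prod_congr rfl fun i hi => (if_neg (h1 i (Finset.mem_range.1 hi))).symm
    · rw [Set.indicator_of_notMem (by exact h)]
      rw [returnTime_eq_succ_iff, not_and_or] at h
      rcases h with h | h
      · push Not at h
        obtain ⟨i, hi, hx⟩ := h
        have hzero : ∏ i ∈ Finset.range n,
            (if ω (i + 1) = xs then 0 else Real.exp (α * C (ω i) - Λ)) = 0 :=
          Finset.prod_eq_zero (Finset.mem_range.2 hi) (if_pos hx)
        rw [hzero, zero_mul, ENNReal.ofReal_zero]
      · rw [if_neg h, mul_zero, ENNReal.ofReal_zero]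
  · congr 2
    · ext x y
      simp [taboo, tilted, mul_comm]
    · ext y
      simp [tilted, mul_comm]

/-- Decomposition of an expectation according to the length of the first excursion. -/
lemma lintegral_eq_tsum_returnTime (P : rowStochastic ℝ X) (x xs : X)
    (hτ : ∀ᵐ ω ∂chainLaw P x, returnTime xs ω ≠ 0) (f : (ℕ → X) → ℝ≥0∞) :
    ∫⁻ ω, f ω ∂chainLaw P x =
      ∑' n, ∫⁻ ω in {ω | returnTime xs ω = n + 1}, f ω ∂chainLaw P x := by
  have hms : ∀ n, MeasurableSet {ω : ℕ → X | returnTime xs ω = n + 1} := fun n =>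
    measurable_returnTime xs (measurableSet_singleton (n + 1))
  rw [← lintegral_iUnion hms]
  · have : (⋃ n, {ω : ℕ → X | returnTime xs ω = n + 1}) =ᵐ[chainLaw P x] Set.univ := by
      filter_upwards [hτ] with ω hω
      refine eq_true (Set.mem_iUnion.2 ⟨returnTime xs ω - 1, ?_⟩) |>.trans (eq_true trivial).symm
      exact (Nat.sub_add_cancel (Nat.one_le_iff_ne_zero.2 hω)).symm
    rw [Measure.restrict_congr_set this, Measure.restrict_univ]
  · intro i j hij
    refine Set.disjoint_left.2 fun ω hi hj => hij ?_
    have hi : returnTime xs ω = i + 1 := hi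
    have hj : returnTime xs ω = j + 1 := hj
    omega

end Law

/-! ### Nonnegative matrices -/

lemma taboo_nonneg {X : Type*} [DecidableEq X] {A : Matrix X X ℝ} (hA : ∀ x y, 0 ≤ A x y)
    (xs x y : X) :
    0 ≤ taboo A xs x y := by
  simp only [taboo, Matrix.of_apply]
  split_ifs
  exacts [le_rfl, hA x y]

section Mat

variable {X : Type*} [Fintype X]

lemma mulVec_mono {A : Matrix X X ℝ} (hA : ∀ x y, 0 ≤ A x y) {u v : X → ℝ}
    (huv : ∀ x, u x ≤ v x) (x : X) : (A *ᵥ u) x ≤ (A *ᵥ v) x :=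
  Finset.sum_le_sum fun y _ => mul_le_mul_of_nonneg_left (huv y) (hA x y)

lemma mulVec_nonneg {A : Matrix X X ℝ} (hA : ∀ x y, 0 ≤ A x y) {u : X → ℝ}
    (hu : ∀ x, 0 ≤ u x) (x : X) : 0 ≤ (A *ᵥ u) x :=
  Finset.sum_nonneg fun y _ => mul_nonneg (hA x y) (hu y)

lemma mulVec_pos {A : Matrix X X ℝ} (hA : ∀ x y, 0 < A x y) {u : X → ℝ}
    (hu : ∀ x, 0 ≤ u x) (hne : ∃ x, 0 < u x) (x : X) : 0 < (A *ᵥ u) x := by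
  obtain ⟨y, hy⟩ := hne
  exact Finset.sum_pos' (fun z _ => mul_nonneg (hA x z).le (hu z))
    ⟨y, Finset.mem_univ y, mul_pos (hA x y) hy⟩

/-- An entry of a matrix times the corresponding coordinate is at most the whole coordinate of the
product, for nonnegative data. -/
lemma apply_mul_le_mulVec {A : Matrix X X ℝ} (hA : ∀ x y, 0 ≤ A x y) {u : X → ℝ}
    (hu : ∀ x, 0 ≤ u x) (x y : X) : A x y * u y ≤ (A *ᵥ u) x :=
  Finset.single_le_sum (f := fun y => A x y * u y) (fun z _ => mul_nonneg (hA x z) (hu z))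
    (Finset.mem_univ y)

variable [DecidableEq X]

lemma pow_mulVec_eigen {A : Matrix X X ℝ} {ρ : ℝ} {v : X → ℝ} (h : A *ᵥ v = ρ • v) (n : ℕ) :
    A ^ n *ᵥ v = ρ ^ n • v := by
  induction n with
  | zero => simp
  | succ n ih => rw [pow_succ, ← Matrix.mulVec_mulVec, h, Matrix.mulVec_smul, ih, smul_smul,
      pow_succ, mul_comm]

lemma pow_nonneg_apply {A : Matrix X X ℝ} (hA : ∀ x y, 0 ≤ A x y) (n : ℕ) (x y : X) :
    0 ≤ (A ^ n) x y :=
  Matrix.pow_apply_nonneg hA n x y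

/-- Quantitative irreducibility is uniform on a compact set of irreducible matrices. -/
lemma exists_uniform_pow_le {S : Set (Matrix X X ℝ)} (hS : IsCompact S)
    (hirr : ∀ Q ∈ S, Q.IsIrreducible) :
    ∃ N : ℕ, ∃ ε : ℝ, 0 < ε ∧ ∀ Q ∈ S, ∀ x y, ∃ k ∈ Finset.Icc 1 N, ε ≤ (Q ^ k) x y := by
  let U : ℕ → Set (Matrix X X ℝ) := fun m =>
    {Q | ∀ x y, ∃ k ∈ Finset.Icc 1 m, ((m : ℝ) + 1)⁻¹ < (Q ^ k) x y}
  have hU : ∀ m, IsOpen (U m) := fun m => by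
    have : U m = ⋂ x, ⋂ y, ⋃ k ∈ Finset.Icc 1 m,
        {Q : Matrix X X ℝ | ((m : ℝ) + 1)⁻¹ < (Q ^ k) x y} := by
      ext Q; simp [U]
    rw [this]
    refine isOpen_iInter_of_finite fun x => isOpen_iInter_of_finite fun y =>
      isOpen_biUnion fun k _ => isOpen_lt continuous_const ?_
    exact (continuous_pow k).matrix_elem x y
  have hmono : Monotone U := fun m n hmn Q hQ x y => by
    obtain ⟨k, hk, hlt⟩ := hQ x y
    rw [Finset.mem_Icc] at hk
    refine ⟨k, Finset.mem_Icc.2 ⟨hk.1, hk.2.trans hmn⟩, lt_of_le_of_lt ?_ hlt⟩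
    gcongr
  have hcover : S ⊆ ⋃ m, U m := fun Q hQ => by
    have hpos := (Matrix.isIrreducible_iff_exists_pow_pos (hirr Q hQ).nonneg).1 (hirr Q hQ)
    choose k hk hkpos using hpos
    have hev : ∀ᶠ m : ℕ in atTop, ∀ x y, k x y ≤ m ∧ ((m : ℝ) + 1)⁻¹ < (Q ^ k x y) x y := by
      refine eventually_all.2 fun x => eventually_all.2 fun y => ?_
      refine (eventually_ge_atTop _).and ?_
      have := tendsto_one_div_add_atTop_nhds_zero_nat (𝕜 := ℝ)
      simp only [one_div] at this
      exact this.eventually_lt_const (hkpos x y)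
    obtain ⟨m, hm⟩ := hev.exists
    exact Set.mem_iUnion.2 ⟨m, fun x y =>
      ⟨k x y, Finset.mem_Icc.2 ⟨hk x y, (hm x y).1⟩, (hm x y).2⟩⟩
  obtain ⟨m, hm⟩ := hS.elim_directed_cover U hU hcover hmono.directed_le
  refine ⟨m, ((m : ℝ) + 1)⁻¹, by positivity, fun Q hQ x y => ?_⟩
  obtain ⟨k, hk, hlt⟩ := hm hQ x y
  exact ⟨k, hk, hlt.le⟩

/-- **Perron–Frobenius**, existence of a positive eigenvector. The eigenvalue is the largest `r`
such that `r u ≤ A u` for some probability vector `u`. -/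
theorem exists_pos_eigenvector [Nonempty X] {A : Matrix X X ℝ} (hA : ∀ x y, 0 ≤ A x y) (N : ℕ)
    (hirr : ∀ x y, ∃ k ∈ Finset.Icc 1 N, 0 < (A ^ k) x y) :
    ∃ ρ : ℝ, ∃ v : X → ℝ, 0 < ρ ∧ (∀ x, 0 < v x) ∧ A *ᵥ v = ρ • v := by
  -- `S` has positive entries and commutes with `A`
  set S : Matrix X X ℝ := ∑ k ∈ Finset.Icc 1 N, A ^ k with hS
  have hSpos : ∀ x y, 0 < S x y := fun x y => by
    obtain ⟨k, hk, hpos⟩ := hirr x y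
    rw [hS, Matrix.sum_apply]
    exact Finset.sum_pos' (fun j _ => pow_nonneg_apply hA j x y) ⟨k, hk, hpos⟩
  have hcomm : A * S = S * A := by
    rw [hS, Finset.mul_sum, Finset.sum_mul]
    exact Finset.sum_congr rfl fun k _ => (pow_succ' A k).symm.trans (pow_succ A k)
  let R : ℝ := ∑ x, ∑ y, A x y
  let Kc : Set (ℝ × (X → ℝ)) :=
    (Set.Icc 0 R ×ˢ stdSimplex ℝ X) ∩ {p | ∀ x, p.1 * p.2 x ≤ (A *ᵥ p.2) x}
  have hKc : IsCompact Kc := by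
    refine (isCompact_Icc.prod (isCompact_stdSimplex ℝ X)).inter_right ?_
    simp only [Set.ofPred_forall]
    refine isClosed_iInter fun x => isClosed_le (by fun_prop) ?_
    exact (continuous_apply x).comp (continuous_const.matrix_mulVec continuous_snd)
  have hmem : ∀ r u, 0 ≤ r → u ∈ stdSimplex ℝ X → (∀ x, r * u x ≤ (A *ᵥ u) x) → (r, u) ∈ Kc := by
    intro r u hr hu hle
    refine ⟨⟨⟨hr, ?_⟩, hu⟩, hle⟩
    calc r = ∑ x, r * u x := by rw [← Finset.mul_sum, hu.2, mul_one]
      _ ≤ ∑ x, (A *ᵥ u) x := Finset.sum_le_sum fun x _ => hle x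
      _ ≤ R := Finset.sum_le_sum fun x _ => Finset.sum_le_sum fun y _ =>
          mul_le_of_le_one_right (hA x y)
            (hu.2 ▸ Finset.single_le_sum (fun z _ => hu.1 z) (Finset.mem_univ y))
  have hne : Kc.Nonempty := by
    obtain ⟨x₀⟩ := ‹Nonempty X›
    refine ⟨(0, Pi.single x₀ 1), hmem _ _ le_rfl (single_mem_stdSimplex ℝ x₀) fun x => ?_⟩
    rw [zero_mul]
    exact mulVec_nonneg hA (fun y => (single_mem_stdSimplex ℝ x₀).1 y) x
  obtain ⟨⟨r, u⟩, ⟨⟨⟨hr0, -⟩, hu⟩, hru⟩, hmax⟩ := hKc.exists_isMaxOn hne continuousOn_fst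
  simp only [Set.mem_ofPred_eq] at hr0 hu hru
  have hupos : ∃ x, 0 < u x := by
    by_contra! h
    have : ∑ x, u x ≤ 0 := Finset.sum_nonpos fun x _ => h x
    linarith [hu.2]
  have hSu : ∀ x, 0 < (S *ᵥ u) x := mulVec_pos hSpos hu.1 hupos
  have heig : A *ᵥ u = r • u := by
    by_contra hneq
    -- otherwise `S u` strictly improves on `u`
    have hz : ∃ x, 0 < (A *ᵥ u - r • u) x := by
      by_contra! h
      exact hneq (funext fun x => le_antisymm (by simpa using h x) (hru x))
    have hSz := mulVec_pos hSpos (u := A *ᵥ u - r • u) (fun x => by simpa using hru x) hz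
    have hSz' : ∀ x, (S *ᵥ (A *ᵥ u - r • u)) x = (A *ᵥ (S *ᵥ u)) x - r * (S *ᵥ u) x := fun x => by
      rw [Matrix.mulVec_sub, Matrix.mulVec_smul, Matrix.mulVec_mulVec, Matrix.mulVec_mulVec, hcomm]
      rfl
    set w := S *ᵥ u with hw
    set s := ∑ x, w x with hs
    have hspos : 0 < s := Finset.sum_pos (fun x _ => hSu x) Finset.univ_nonempty
    obtain ⟨x₁, hx₁⟩ := Finite.exists_min (S *ᵥ (A *ᵥ u - r • u))
    set δ := (S *ᵥ (A *ᵥ u - r • u)) x₁ with hδ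
    have hδpos : 0 < δ := hSz x₁
    have hin : (r + δ / s, s⁻¹ • w) ∈ Kc := by
      refine hmem _ _ (by positivity) ⟨fun x => ?_, ?_⟩ fun x => ?_
      · exact mul_nonneg (inv_nonneg.2 hspos.le) (hSu x).le
      · simp only [Pi.smul_apply, smul_eq_mul, ← Finset.mul_sum]
        exact inv_mul_cancel₀ hspos.ne'
      · rw [Matrix.mulVec_smul, Pi.smul_apply, Pi.smul_apply, smul_eq_mul, smul_eq_mul,
          mul_left_comm]
        refine mul_le_mul_of_nonneg_left ?_ (inv_nonneg.2 hspos.le)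
        have h1 : w x ≤ s := Finset.single_le_sum (fun z _ => (hSu z).le) (Finset.mem_univ x)
        have h2 := hx₁ x
        rw [hSz' x] at h2
        have h3 : δ / s * w x ≤ δ := by
          rw [div_mul_eq_mul_div, div_le_iff₀ hspos]
          exact mul_le_mul_of_nonneg_left h1 hδpos.le
        linarith
    have := hmax hin
    simp only [Set.mem_ofPred_eq] at this
    have : 0 < δ / s := by positivity
    linarith
  have hSu' : ∀ x, (S *ᵥ u) x = (∑ k ∈ Finset.Icc 1 N, r ^ k) * u x := fun x => by
    rw [hS, Matrix.sum_mulVec, Finset.sum_apply, Finset.sum_mul]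
    exact Finset.sum_congr rfl fun k _ => by rw [pow_mulVec_eigen heig]; rfl
  have hsum : 0 ≤ ∑ k ∈ Finset.Icc 1 N, r ^ k := Finset.sum_nonneg fun k _ => pow_nonneg hr0 k
  -- `S u > 0` is a multiple of `u`, so `u > 0`; the multiple vanishes if `r = 0`
  refine ⟨r, u, lt_of_le_of_ne hr0 fun h0 => ?_, fun x => ?_, heig⟩
  · obtain ⟨x⟩ := ‹Nonempty X›
    have := hSu x
    rw [hSu', ← h0, Finset.sum_eq_zero fun k hk => zero_pow
      (Nat.one_le_iff_ne_zero.1 (Finset.mem_Icc.1 hk).1), zero_mul] at this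
    exact this.false
  · exact pos_of_mul_pos_right (hSu' x ▸ hSu x) hsum

/-- The growth rate of `A ^ n 1` is the Perron eigenvalue. -/
lemma tendsto_log_pow_mulVec_one [Nonempty X] {A : Matrix X X ℝ} (hA : ∀ x y, 0 ≤ A x y) {ρ : ℝ}
    (hρ : 0 < ρ) {v : X → ℝ} (hv : ∀ x, 0 < v x) (h : A *ᵥ v = ρ • v) (x : X) :
    Tendsto (fun n : ℕ => (1 / (n : ℝ)) * Real.log ((A ^ n *ᵥ fun _ => 1) x)) atTop
      (𝓝 (Real.log ρ)) := by
  obtain ⟨a, ha⟩ := Finite.exists_min v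
  obtain ⟨b, hb⟩ := Finite.exists_max v
  have hlow : ∀ n : ℕ, ρ ^ n * (v x / v b) ≤ (A ^ n *ᵥ fun _ => 1) x := fun n => by
    have h1 := mulVec_mono (pow_nonneg_apply hA n) (u := (v b)⁻¹ • v) (v := fun _ => 1)
      (fun y => by
        rw [Pi.smul_apply, smul_eq_mul, inv_mul_le_iff₀ (hv b), mul_one]
        exact hb y) x
    rw [Matrix.mulVec_smul, pow_mulVec_eigen h] at h1
    refine le_of_eq_of_le ?_ h1
    simp only [Pi.smul_apply, smul_eq_mul]
    ring
  have hup : ∀ n : ℕ, (A ^ n *ᵥ fun _ => 1) x ≤ ρ ^ n * (v x / v a) := fun n => by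
    have h1 := mulVec_mono (pow_nonneg_apply hA n) (u := fun _ => 1) (v := (v a)⁻¹ • v)
      (fun y => by
        rw [Pi.smul_apply, smul_eq_mul, le_inv_mul_iff₀ (hv a), mul_one]
        exact ha y) x
    rw [Matrix.mulVec_smul, pow_mulVec_eigen h] at h1
    refine h1.trans_eq ?_
    simp only [Pi.smul_apply, smul_eq_mul]
    ring
  have hlim : ∀ c : ℝ, 0 < c → Tendsto (fun n : ℕ => (1 / (n : ℝ)) * Real.log (ρ ^ n * c)) atTop
      (𝓝 (Real.log ρ)) := fun c hc => by
    have h1 : Tendsto (fun n : ℕ => Real.log ρ + Real.log c * (1 / (n : ℝ))) atTop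
        (𝓝 (Real.log ρ + Real.log c * 0)) :=
      tendsto_const_nhds.add (tendsto_one_div_atTop_nhds_zero_nat.const_mul _)
    rw [mul_zero, add_zero] at h1
    refine h1.congr' ?_
    filter_upwards [eventually_gt_atTop 0] with n hn
    have hn : (n : ℝ) ≠ 0 := by positivity
    rw [Real.log_mul (by positivity) hc.ne', Real.log_pow]
    field_simp
  have hcb : 0 < v x / v b := div_pos (hv x) (hv b)
  have hca : 0 < v x / v a := div_pos (hv x) (hv a)
  refine tendsto_of_tendsto_of_tendsto_of_le_of_le (hlim _ hcb) (hlim _ hca) (fun n => ?_)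
    fun n => ?_
  · have h0 : 0 < ρ ^ n * (v x / v b) := by positivity
    exact mul_le_mul_of_nonneg_left (Real.log_le_log h0 (hlow n)) (by positivity)
  · have h0 : 0 < ρ ^ n * (v x / v b) := by positivity
    exact mul_le_mul_of_nonneg_left (Real.log_le_log (h0.trans_le (hlow n)) (hup n))
      (by positivity)

lemma taboo_mulVec (A : Matrix X X ℝ) (xs : X) (u : X → ℝ) (x : X) :
    (taboo A xs *ᵥ u) x = (A *ᵥ u) x - A x xs * u xs := by
  simp only [Matrix.mulVec, dotProduct, taboo, Matrix.of_apply, ite_mul, zero_mul]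
  rw [eq_sub_iff_add_eq, ← Finset.sum_erase_add _ _ (Finset.mem_univ xs),
    ← Finset.sum_erase_add Finset.univ (fun y => A x y * u y) (Finset.mem_univ xs), if_pos rfl,
    add_zero]
  congr 1
  exact Finset.sum_congr rfl fun y hy => if_neg (Finset.ne_of_mem_erase hy)

/-- For a positive `v` fixed by `A`, `v (xs) * A ^ n (x, xs)` is at most the `v`-mass that has
entered `xs` by time `n`. -/
lemma pow_apply_mul_le_sub_taboo {A : Matrix X X ℝ} (hA : ∀ x y, 0 ≤ A x y) {v : X → ℝ}
    (hv : ∀ x, 0 ≤ v x) (h : A *ᵥ v = v) (xs : X) (n : ℕ) (x : X) :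
    (A ^ (n + 1)) x xs * v xs ≤ v x - (taboo A xs ^ (n + 1) *ᵥ v) x := by
  induction n generalizing x with
  | zero => simp [taboo_mulVec, h]
  | succ n ih =>
    have h1 : (taboo A xs ^ (n + 2) *ᵥ v) x ≤
        (taboo A xs *ᵥ (v - fun y => (A ^ (n + 1)) y xs * v xs)) x := by
      rw [pow_succ', ← Matrix.mulVec_mulVec]
      refine mulVec_mono (taboo_nonneg hA xs) (fun y => ?_) x
      have := ih y
      simp only [Pi.sub_apply]
      linarith
    have h2 : (A ^ (n + 2)) x xs * v xs = (A *ᵥ fun y => (A ^ (n + 1)) y xs * v xs) x := by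
      rw [pow_succ' A (n + 1), Matrix.mul_apply, Finset.sum_mul]
      exact Finset.sum_congr rfl fun y _ => mul_assoc _ _ _
    have hpow : A ^ (n + 1) *ᵥ v = v := by
      simpa using pow_mulVec_eigen (ρ := 1) (by simpa using h) (n + 1)
    have h3 : (A ^ (n + 1)) xs xs * v xs ≤ v xs := by
      simpa [hpow] using apply_mul_le_mulVec (pow_nonneg_apply hA (n + 1)) hv xs xs
    rw [taboo_mulVec, Matrix.mulVec_sub, h] at h1
    simp only [Pi.sub_apply] at h1
    have h4 := mul_nonneg (hA x xs) (sub_nonneg.2 h3)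
    rw [show n + 1 + 1 = n + 2 from rfl, h2]
    linarith

lemma taboo_mulVec_le {A : Matrix X X ℝ} (hA : ∀ x y, 0 ≤ A x y) {v : X → ℝ}
    (hv : ∀ x, 0 ≤ v x) (h : A *ᵥ v = v) (xs x : X) : (taboo A xs *ᵥ v) x ≤ v x := by
  rw [taboo_mulVec, h]
  linarith [mul_nonneg (hA x xs) (hv xs)]

lemma antitone_taboo_pow_mulVec {A : Matrix X X ℝ} (hA : ∀ x y, 0 ≤ A x y) {v : X → ℝ}
    (hv : ∀ x, 0 ≤ v x) (h : A *ᵥ v = v) (xs x : X) :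
    Antitone fun n => (taboo A xs ^ n *ᵥ v) x := by
  refine antitone_nat_of_succ_le fun n => ?_
  rw [pow_succ, ← Matrix.mulVec_mulVec]
  exact mulVec_mono (pow_nonneg_apply (taboo_nonneg hA xs) n) (taboo_mulVec_le hA hv h xs) x

/-- Geometric decay of the mass that has not yet entered `xs`. -/
lemma taboo_pow_mulVec_le {A : Matrix X X ℝ} (hA : ∀ x y, 0 ≤ A x y) {v : X → ℝ}
    (hv : ∀ x, 0 ≤ v x) (h : A *ᵥ v = v) (xs : X) {N : ℕ} {ε : ℝ} (hε1 : ε ≤ 1)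
    (hN : ∀ x, ∃ k ∈ Finset.Icc 1 N, ε * v x ≤ (A ^ k) x xs * v xs) (m : ℕ) (x : X) :
    (taboo A xs ^ (N * m) *ᵥ v) x ≤ (1 - ε) ^ m * v x := by
  have hT := pow_nonneg_apply (taboo_nonneg hA xs)
  have hstep : ∀ x, (taboo A xs ^ N *ᵥ v) x ≤ (1 - ε) * v x := fun x => by
    obtain ⟨k, hk, hle⟩ := hN x
    rw [Finset.mem_Icc] at hk
    obtain ⟨j, rfl⟩ : ∃ j, k = j + 1 := ⟨k - 1, by omega⟩
    have h1 := pow_apply_mul_le_sub_taboo hA hv h xs j x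
    have h2 : (taboo A xs ^ N *ᵥ v) x ≤ (taboo A xs ^ (j + 1) *ᵥ v) x :=
      antitone_taboo_pow_mulVec hA hv h xs x hk.2
    linarith
  induction m generalizing x with
  | zero => simp
  | succ m ih =>
    rw [Nat.mul_succ, pow_add, ← Matrix.mulVec_mulVec]
    have h1 := mulVec_mono (hT (N * m)) (v := (1 - ε) • v) hstep x
    rw [Matrix.mulVec_smul] at h1
    refine h1.trans ?_
    rw [Pi.smul_apply, smul_eq_mul, pow_succ', mul_assoc]
    exact mul_le_mul_of_nonneg_left (ih x) (by linarith)

end Mat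

/-! ### The exponent and the law of the excursion weight -/

/-- A nonincreasing sequence that decays geometrically along the multiples of `N` decays
geometrically. -/
lemma exists_le_geometric {w : ℕ → ℝ} (hw : Antitone w) {N : ℕ} (hN : 0 < N) {b ε : ℝ}
    (hb : 0 ≤ b) (hε : 0 < ε) (hε1 : ε ≤ 1) (h : ∀ m, w (N * m) ≤ (1 - ε) ^ m * b) :
    ∃ D q : ℝ, 0 ≤ D ∧ 0 < q ∧ q < 1 ∧ ∀ n, w n ≤ D * q ^ n := by
  -- `1 - ε` may vanish, hence the maximum with `1 / 2`
  set γ : ℝ := max (1 - ε) (1 / 2) with hγ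
  have hγ0 : 0 < γ := lt_max_of_lt_right (by norm_num)
  have hγ1 : γ < 1 := max_lt (by linarith) (by norm_num)
  set q : ℝ := γ ^ ((N : ℝ)⁻¹) with hq
  have hq0 : 0 < q := Real.rpow_pos_of_pos hγ0 _
  have hq1 : q < 1 := Real.rpow_lt_one hγ0.le hγ1 (by positivity)
  have hqN : q ^ N = γ := Real.rpow_inv_natCast_pow hγ0.le hN.ne'
  refine ⟨b / γ, q, by positivity, hq0, hq1, fun n => ?_⟩
  have h1 : w n ≤ (1 - ε) ^ (n / N) * b :=
    (hw (Nat.mul_div_le n N)).trans (h (n / N))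
  have h2 : (1 - ε) ^ (n / N) ≤ γ ^ (n / N) :=
    pow_le_pow_left₀ (by linarith) (le_max_left _ _) _
  have h3 : γ ^ (n / N) * γ ≤ q ^ n := by
    rw [← pow_succ, ← hqN, ← pow_mul]
    exact pow_le_pow_of_le_one hq0.le hq1.le (Nat.lt_mul_div_succ n hN).le
  calc w n ≤ γ ^ (n / N) * b := h1.trans (mul_le_mul_of_nonneg_right h2 hb)
    _ ≤ q ^ n / γ * b := mul_le_mul_of_nonneg_right ((le_div_iff₀ hγ0).2 h3) hb
    _ = b / γ * q ^ n := by ring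

/-- A telescoping sum in the extended nonnegative reals. -/
lemma tsum_ofReal_sub_succ {w : ℕ → ℝ} (hw : Antitone w) (h0 : Tendsto w atTop (𝓝 0)) :
    ∑' n, ENNReal.ofReal (w n - w (n + 1)) = ENNReal.ofReal (w 0) := by
  have hs : HasSum (fun n => w n - w (n + 1)) (w 0) := by
    rw [hasSum_iff_tendsto_nat_of_nonneg fun n => sub_nonneg.2 (hw n.le_succ)]
    simp only [Finset.sum_range_sub']
    simpa using tendsto_const_nhds.sub h0
  rw [← ENNReal.ofReal_tsum_of_nonneg (fun n => sub_nonneg.2 (hw n.le_succ)) hs.summable,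
    hs.tsum_eq]

lemma tilted_nonneg {X : Type*} {P : Matrix X X ℝ} (hP : ∀ x y, 0 ≤ P x y) (C : X → ℝ)
    (α Λ : ℝ) (x y : X) :
    0 ≤ tilted P C α Λ x y :=
  mul_nonneg (Real.exp_pos _).le (hP x y)

lemma tilted_zero {X : Type*} (P : Matrix X X ℝ) (C : X → ℝ) : tilted P C 0 0 = P := by
  ext x y
  simp [tilted]

section Excursion

variable {X : Type*} [Fintype X] [DecidableEq X]

/-- The first-entrance masses telescope. -/
lemma taboo_pow_mulVec_col {A : Matrix X X ℝ} {v : X → ℝ} (h : A *ᵥ v = v) (xs : X) (n : ℕ)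
    (x : X) :
    (taboo A xs ^ n *ᵥ fun y => A y xs) x * v xs =
      (taboo A xs ^ n *ᵥ v) x - (taboo A xs ^ (n + 1) *ᵥ v) x := by
  have hcol : v xs • (fun y => A y xs) = v - taboo A xs *ᵥ v := by
    ext y
    rw [Pi.sub_apply, taboo_mulVec, h, Pi.smul_apply, smul_eq_mul]
    ring
  rw [pow_succ, ← Matrix.mulVec_mulVec, ← Pi.sub_apply, ← Matrix.mulVec_sub, ← hcol,
    Matrix.mulVec_smul, Pi.smul_apply, smul_eq_mul, mul_comm]

/-- Tilting preserves the uniform irreducibility of `P`, up to a factor that depends on `K` only. -/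
lemma pow_mul_le_tilted_pow {P : Matrix X X ℝ} (hP : ∀ x y, 0 ≤ P x y) {C : X → ℝ} {α Λ K : ℝ}
    (hK : ∀ x, |α * C x| ≤ K) (hΛ : |Λ| ≤ K) (k : ℕ) (x y : X) :
    Real.exp (-(2 * K)) ^ k * (P ^ k) x y ≤ (tilted P C α Λ ^ k) x y := by
  induction k generalizing x y with
  | zero => simp
  | succ k ih =>
    rw [pow_succ P, pow_succ (tilted P C α Λ), Matrix.mul_apply, Matrix.mul_apply, Finset.mul_sum]
    refine Finset.sum_le_sum fun z _ => ?_
    rw [pow_succ, mul_mul_mul_comm]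
    refine mul_le_mul (ih x z) ?_ (mul_nonneg (Real.exp_pos _).le (hP z y))
      (pow_nonneg_apply (tilted_nonneg hP C α Λ) k x z)
    refine mul_le_mul_of_nonneg_right (Real.exp_le_exp.2 ?_) (hP z y)
    linarith [(abs_le.1 (hK z)).1, (abs_le.1 hΛ).2]

lemma mulVec_one (P : rowStochastic ℝ X) : (P : Matrix X X ℝ) *ᵥ (fun _ => 1) = fun _ => 1 := by
  ext x
  simpa [Matrix.mulVec, dotProduct] using sum_row_of_mem_rowStochastic P.2 x

lemma antitone_taboo_div {A : Matrix X X ℝ} (hA : ∀ x y, 0 ≤ A x y) {v : X → ℝ}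
    (hv : ∀ x, 0 < v x) (h : A *ᵥ v = v) (xs : X) :
    Antitone fun n => (taboo A xs ^ n *ᵥ v) xs / v xs := fun _ _ hmn =>
  div_le_div_of_nonneg_right (antitone_taboo_pow_mulVec hA (fun x => (hv x).le) h xs xs hmn)
    (hv xs).le

/-- The proportion of `v`-mass started at `xs` that has not returned by time `n` decays
geometrically. -/
lemma exists_taboo_div_le_geometric {A : Matrix X X ℝ} (hA : ∀ x y, 0 ≤ A x y) {v : X → ℝ}
    (hv : ∀ x, 0 < v x) (h : A *ᵥ v = v) (xs : X) {N : ℕ} {ε : ℝ} (hε : 0 < ε)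
    (hN : ∀ x, ∃ k ∈ Finset.Icc 1 N, ε * v x ≤ (A ^ k) x xs * v xs) :
    ε ≤ 1 ∧ (∀ m, (taboo A xs ^ (N * m) *ᵥ v) xs / v xs ≤ (1 - ε) ^ m) ∧
      ∃ D q : ℝ, 0 ≤ D ∧ 0 < q ∧ q < 1 ∧
        ∀ n, (taboo A xs ^ n *ᵥ v) xs / v xs ≤ D * q ^ n := by
  obtain ⟨k, hk, hle⟩ := hN xs
  have hNpos : 0 < N := (Finset.mem_Icc.1 hk).1.trans (Finset.mem_Icc.1 hk).2
  have hε1 : ε ≤ 1 := by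
    have hpow : A ^ k *ᵥ v = v := by
      simpa using pow_mulVec_eigen (ρ := 1) (by simpa using h) k
    have h1 := apply_mul_le_mulVec (pow_nonneg_apply hA k) (fun y => (hv y).le) xs xs
    rw [hpow] at h1
    exact le_of_mul_le_mul_right (by linarith) (hv xs)
  have hm : ∀ m, (taboo A xs ^ (N * m) *ᵥ v) xs / v xs ≤ (1 - ε) ^ m := fun m => by
    rw [div_le_iff₀ (hv xs)]
    exact taboo_pow_mulVec_le hA (fun x => (hv x).le) h xs hε1 hN m xs
  exact ⟨hε1, hm, exists_le_geometric (antitone_taboo_div hA hv h xs) hNpos zero_le_one hε hε1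
    fun m => by rw [mul_one]; exact hm m⟩

variable [MeasurableSpace X] [MeasurableSingletonClass X]

lemma finiteHorizonCost_eq (P : rowStochastic ℝ X) (C : X → ℝ) (α : ℝ) (x : X) (n : ℕ) :
    finiteHorizonCost P C α x n =
      (1 / (n : ℝ)) * Real.log ((tilted (P : Matrix X X ℝ) C α 0 ^ n *ᵥ fun _ => 1) x) := by
  have hmeas : Measurable fun ω : ℕ → X => Real.exp (α * ∑ i ∈ Finset.range n, C (ω i)) := by
    refine Real.measurable_exp.comp (Measurable.const_mul ?_ _)
    exact Finset.measurable_fun_sum _ fun i _ =>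
      (measurable_of_countable C).comp (measurable_pi_apply i)
  have hnn : 0 ≤ (tilted (P : Matrix X X ℝ) C α 0 ^ n *ᵥ fun _ => 1) x :=
    mulVec_nonneg (pow_nonneg_apply (tilted_nonneg P.2.1 C α 0) n) (fun _ => zero_le_one) x
  rw [finiteHorizonCost, integral_eq_lintegral_of_nonneg_ae
    (Eventually.of_forall fun ω => (Real.exp_pos _).le) hmeas.aestronglyMeasurable]
  have key := lintegral_prod_mul P x (K := fun x _ => Real.exp (α * C x))
    (fun _ _ => (Real.exp_pos _).le) n (u := fun _ => 1) fun _ => zero_le_one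
  have hB : (Matrix.of fun x y => (P : Matrix X X ℝ) x y * Real.exp (α * C x)) =
      tilted (P : Matrix X X ℝ) C α 0 := by
    ext x y
    simp [tilted, mul_comm]
  rw [hB] at key
  simp only [mul_one, ← Real.exp_sum, ← Finset.mul_sum] at key
  rw [key, ENNReal.toReal_ofReal hnn]

/-- The Perron eigenvector of the tilted matrix, normalised to eigenvalue `1` by the exponent `Λ`,
with bounds that depend on the chain and the cost only through `K`, `N` and `ε`. -/
theorem exists_perron_exponent (P : rowStochastic ℝ X) {C : X → ℝ} {α K : ℝ} (xs : X)
    (hK : ∀ x, |α * C x| ≤ K) {N : ℕ} {ε : ℝ} (hε : 0 < ε)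
    (hN : ∀ x y, ∃ k ∈ Finset.Icc 1 N, ε ≤ ((P : Matrix X X ℝ) ^ k) x y) :
    ∃ Λ : ℝ, ∃ v : X → ℝ, |Λ| ≤ K ∧ (∀ x, 0 < v x) ∧
      tilted (P : Matrix X X ℝ) C α Λ *ᵥ v = v ∧
      (∀ x, ∃ k ∈ Finset.Icc 1 N, (Real.exp (-(2 * K)) ^ N * ε) ^ 2 * v x ≤
        (tilted (P : Matrix X X ℝ) C α Λ ^ k) x xs * v xs) ∧
      ∀ x, Tendsto (finiteHorizonCost P C α x) atTop (𝓝 Λ) := by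
  have : Nonempty X := ⟨xs⟩
  have hK0 : 0 ≤ K := (abs_nonneg _).trans (hK xs)
  have hPnn := P.2.1
  have hentry : ∀ Λ, |Λ| ≤ K → ∀ x y, ∃ k ∈ Finset.Icc 1 N,
      Real.exp (-(2 * K)) ^ N * ε ≤ (tilted (P : Matrix X X ℝ) C α Λ ^ k) x y := by
    intro Λ hΛ x y
    obtain ⟨k, hk, hle⟩ := hN x y
    refine ⟨k, hk, le_trans ?_ (pow_mul_le_tilted_pow hPnn hK hΛ k x y)⟩
    refine mul_le_mul ?_ hle hε.le (by positivity)
    exact pow_le_pow_of_le_one (Real.exp_pos _).le (Real.exp_le_one_iff.2 (by linarith))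
      (Finset.mem_Icc.1 hk).2
  have hη : 0 < Real.exp (-(2 * K)) ^ N * ε := by positivity
  obtain ⟨ρ, v, hρ, hv, heig⟩ := exists_pos_eigenvector
    (tilted_nonneg hPnn C α 0) N fun x y => by
      obtain ⟨k, hk, hle⟩ := hentry 0 (by simpa using hK0) x y
      exact ⟨k, hk, hη.trans_le hle⟩
  have hρv : ∀ x, ρ * v x = Real.exp (α * C x) * ∑ y, (P : Matrix X X ℝ) x y * v y := fun x => by
    have := congrFun heig x
    rw [Pi.smul_apply, smul_eq_mul] at this
    rw [← this, Finset.mul_sum]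
    refine Finset.sum_congr rfl fun y _ => ?_
    change Real.exp (α * C x - 0) * (P : Matrix X X ℝ) x y * v y = _
    rw [sub_zero, mul_assoc]
  have hrow : ∀ x, ∑ y, (P : Matrix X X ℝ) x y = 1 := sum_row_of_mem_rowStochastic P.2
  have hup : ρ ≤ Real.exp K := by
    obtain ⟨b, hb⟩ := Finite.exists_max v
    have h1 : ∑ y, (P : Matrix X X ℝ) b y * v y ≤ v b := by
      calc ∑ y, (P : Matrix X X ℝ) b y * v y ≤ ∑ y, (P : Matrix X X ℝ) b y * v b :=
            Finset.sum_le_sum fun y _ => mul_le_mul_of_nonneg_left (hb y) (hPnn b y)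
        _ = v b := by rw [← Finset.sum_mul, hrow, one_mul]
    refine le_of_mul_le_mul_right ?_ (hv b)
    rw [hρv]
    exact mul_le_mul (Real.exp_le_exp.2 (abs_le.1 (hK b)).2) h1
      (Finset.sum_nonneg fun y _ => mul_nonneg (hPnn b y) (hv y).le) (Real.exp_pos _).le
  have hlow : Real.exp (-K) ≤ ρ := by
    obtain ⟨a, ha⟩ := Finite.exists_min v
    have h1 : v a ≤ ∑ y, (P : Matrix X X ℝ) a y * v y := by
      calc v a = ∑ y, (P : Matrix X X ℝ) a y * v a := by rw [← Finset.sum_mul, hrow, one_mul]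
        _ ≤ ∑ y, (P : Matrix X X ℝ) a y * v y :=
            Finset.sum_le_sum fun y _ => mul_le_mul_of_nonneg_left (ha y) (hPnn a y)
    refine le_of_mul_le_mul_right ?_ (hv a)
    rw [hρv]
    exact mul_le_mul (Real.exp_le_exp.2 (abs_le.1 (hK a)).1) h1 (hv a).le (Real.exp_pos _).le
  have hΛ : |Real.log ρ| ≤ K := abs_le.2
    ⟨(Real.le_log_iff_exp_le hρ).2 hlow, (Real.log_le_iff_le_exp hρ).2 hup⟩
  have hfix : tilted (P : Matrix X X ℝ) C α (Real.log ρ) *ᵥ v = v := by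
    have : tilted (P : Matrix X X ℝ) C α (Real.log ρ) =
        ρ⁻¹ • tilted (P : Matrix X X ℝ) C α 0 := by
      ext x y
      simp only [tilted, Matrix.of_apply, Matrix.smul_apply, smul_eq_mul, sub_zero]
      rw [Real.exp_sub, Real.exp_log hρ]
      ring
    rw [this, Matrix.smul_mulVec, heig, smul_smul, inv_mul_cancel₀ hρ.ne', one_smul]
  refine ⟨Real.log ρ, v, hΛ, hv, hfix, fun x => ?_, fun x => ?_⟩
  · obtain ⟨k, hk, hle⟩ := hentry _ hΛ x xs
    -- the same entrywise bound compares `v x` with `v xs`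
    obtain ⟨j, hj, hle'⟩ := hentry _ hΛ xs x
    refine ⟨k, hk, ?_⟩
    have hpow : tilted (P : Matrix X X ℝ) C α (Real.log ρ) ^ j *ᵥ v = v := by
      simpa using pow_mulVec_eigen (ρ := 1) (by simpa using hfix) j
    have h1 := apply_mul_le_mulVec (pow_nonneg_apply (tilted_nonneg hPnn C α (Real.log ρ)) j)
      (fun y => (hv y).le) xs x
    rw [hpow] at h1
    rw [sq, mul_assoc]
    refine mul_le_mul hle ((mul_le_mul_of_nonneg_right hle' (hv x).le).trans h1)
      (mul_nonneg hη.le (hv x).le) (hη.le.trans hle)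
  · have := tendsto_log_pow_mulVec_one (tilted_nonneg hPnn C α 0) hρ hv heig x
    exact this.congr fun n => (finiteHorizonCost_eq P C α x n).symm

lemma setLIntegral_excursionWeight_eq_sub (P : rowStochastic ℝ X) {C : X → ℝ} {α Λ : ℝ} (xs : X)
    {v : X → ℝ} (hv : ∀ x, 0 < v x) (h : tilted (P : Matrix X X ℝ) C α Λ *ᵥ v = v) (n : ℕ) :
    ∫⁻ ω in {ω | returnTime xs ω = n + 1}, ENNReal.ofReal (excursionWeight C α xs Λ ω)
        ∂chainLaw P xs =
      ENNReal.ofReal ((taboo (tilted (P : Matrix X X ℝ) C α Λ) xs ^ n *ᵥ v) xs / v xs -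
        (taboo (tilted (P : Matrix X X ℝ) C α Λ) xs ^ (n + 1) *ᵥ v) xs / v xs) := by
  rw [setLIntegral_excursionWeight, ← sub_div, ← taboo_pow_mulVec_col h,
    mul_div_cancel_right₀ _ (hv xs).ne']

/-- `E[H(Λ); τ < ∞] = 1` at the exponent `Λ` for which the tilted matrix has a positive fixed
vector. -/
lemma tsum_setLIntegral_excursionWeight (P : rowStochastic ℝ X) {C : X → ℝ} {α Λ : ℝ} (xs : X)
    {v : X → ℝ} (hv : ∀ x, 0 < v x) (h : tilted (P : Matrix X X ℝ) C α Λ *ᵥ v = v)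
    {N : ℕ} {ε : ℝ} (hε : 0 < ε) (hN : ∀ x, ∃ k ∈ Finset.Icc 1 N,
      ε * v x ≤ (tilted (P : Matrix X X ℝ) C α Λ ^ k) x xs * v xs) :
    ∑' n, ∫⁻ ω in {ω | returnTime xs ω = n + 1},
      ENNReal.ofReal (excursionWeight C α xs Λ ω) ∂chainLaw P xs = 1 := by
  have hA := tilted_nonneg P.2.1 C α Λ
  obtain ⟨-, -, D, q, hD, hq0, hq1, hle⟩ := exists_taboo_div_le_geometric hA hv h xs hε hN
  simp only [setLIntegral_excursionWeight_eq_sub P xs hv h]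
  rw [tsum_ofReal_sub_succ (antitone_taboo_div hA hv h xs)]
  · simp [div_self (hv xs).ne']
  · refine squeeze_zero (fun n => ?_) hle ?_
    · exact div_nonneg (mulVec_nonneg (pow_nonneg_apply (taboo_nonneg hA xs) n)
        (fun x => (hv x).le) xs) (hv xs).le
    · simpa using (tendsto_pow_atTop_nhds_zero_of_lt_one hq0.le hq1).const_mul D

/-- With zero cost and `Λ = 0` the excursion weight is `1`, so that statements on excursion weights
specialise to the law of the return time. -/
lemma measure_returnTime_eq_succ (P : rowStochastic ℝ X) (xs : X) (n : ℕ) :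
    chainLaw P xs {ω | returnTime xs ω = n + 1} =
      ∫⁻ ω in {ω | returnTime xs ω = n + 1},
        ENNReal.ofReal (excursionWeight (fun _ => 0) 0 xs 0 ω) ∂chainLaw P xs := by
  simp [excursionWeight]

/-- The chain returns to `xs` almost surely. -/
lemma ae_returnTime_ne_zero (P : rowStochastic ℝ X) (xs : X) {N : ℕ} {ε : ℝ} (hε : 0 < ε)
    (hN : ∀ x y, ∃ k ∈ Finset.Icc 1 N, ε ≤ ((P : Matrix X X ℝ) ^ k) x y) :
    ∀ᵐ ω ∂chainLaw P xs, returnTime xs ω ≠ 0 := by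
  have hsum := tsum_setLIntegral_excursionWeight P (C := fun _ => 0) (α := 0) (Λ := 0) xs
    (v := fun _ => 1) (fun _ => one_pos) (by rw [tilted_zero, mulVec_one]) hε
    (fun x => by simpa [tilted_zero] using hN x xs)
  simp only [← measure_returnTime_eq_succ] at hsum
  have hms : ∀ n, MeasurableSet {ω : ℕ → X | returnTime xs ω = n + 1} := fun n =>
    measurable_returnTime xs (measurableSet_singleton (n + 1))
  rw [← measure_iUnion (fun i j hij => ?_) hms] at hsum
  · have := (prob_compl_eq_zero_iff (MeasurableSet.iUnion hms)).2 hsum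
    refine measure_mono_null (fun ω hω => ?_) this
    have h0 : returnTime xs ω = 0 := not_not.1 hω
    simp [h0]
  · refine Set.disjoint_left.2 fun ω hi hj => hij ?_
    have hi : returnTime xs ω = i + 1 := hi
    have hj : returnTime xs ω = j + 1 := hj
    omega

/-- The return time has finite fourth moment, by the geometric decay of its tail. -/
lemma lintegral_returnTime_pow_lt_top (P : rowStochastic ℝ X) (xs : X) {N : ℕ} {ε : ℝ}
    (hε : 0 < ε) (hN : ∀ x y, ∃ k ∈ Finset.Icc 1 N, ε ≤ ((P : Matrix X X ℝ) ^ k) x y) :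
    ∫⁻ ω, ENNReal.ofReal ((returnTime xs ω : ℝ) ^ 4) ∂chainLaw P xs < ∞ := by
  have h1 : (P : Matrix X X ℝ) *ᵥ (fun _ => 1) = fun _ => 1 := mulVec_one P
  obtain ⟨-, -, D, q, hD, hq0, hq1, hle⟩ := exists_taboo_div_le_geometric P.2.1
    (v := fun _ => 1) (fun _ => one_pos) h1 xs hε (fun x => by simpa using hN x xs)
  have hsum : Summable fun n : ℕ => ((n + 1 : ℕ) : ℝ) ^ 4 * (D * q ^ n) := by
    have h4 := summable_pow_mul_geometric_of_norm_lt_one 4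
      (show ‖q‖ < 1 by rwa [Real.norm_of_nonneg hq0.le])
    refine (((summable_nat_add_iff 1).2 h4).mul_left (D / q)).congr fun n => ?_
    rw [pow_succ q]
    field_simp
  rw [lintegral_eq_tsum_returnTime P xs xs (ae_returnTime_ne_zero P xs hε hN)]
  refine lt_of_le_of_lt (ENNReal.tsum_le_tsum fun n => ?_) hsum.tsum_ofReal_lt_top
  have hms : MeasurableSet {ω : ℕ → X | returnTime xs ω = n + 1} :=
    measurable_returnTime xs (measurableSet_singleton (n + 1))
  rw [setLIntegral_congr_fun (g := fun _ => ENNReal.ofReal (((n + 1 : ℕ) : ℝ) ^ 4)) hms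
    (fun ω hω => by
      have hω : returnTime xs ω = n + 1 := hω
      simp only [hω]), setLIntegral_const, ENNReal.ofReal_mul (by positivity)]
  gcongr
  rw [measure_returnTime_eq_succ, setLIntegral_excursionWeight_eq_sub P xs (v := fun _ => 1)
    (fun _ => one_pos) (by rw [tilted_zero, h1])]
  refine ENNReal.ofReal_le_ofReal ((sub_le_self _ ?_).trans ?_)
  · exact div_nonneg (mulVec_nonneg (pow_nonneg_apply
      (taboo_nonneg (tilted_nonneg P.2.1 _ _ _) xs) _) (fun _ => zero_le_one) xs) zero_le_one
  · rw [tilted_zero]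
    exact hle n

end Excursion

/-! ### The truncated equation -/

lemma excursionWeight_pos {X : Type*} (C : X → ℝ) (α : ℝ) (xs : X) (Λ : ℝ) (ω : ℕ → X) :
    0 < excursionWeight C α xs Λ ω :=
  Real.exp_pos _

lemma excursionWeight_sub {X : Type*} (C : X → ℝ) (α : ℝ) (xs : X) (Λ δ : ℝ) (ω : ℕ → X) :
    excursionWeight C α xs (Λ - δ) ω =
      Real.exp (returnTime xs ω * δ) * excursionWeight C α xs Λ ω := by
  rw [excursionWeight, excursionWeight, ← Real.exp_add]
  simp only [Finset.sum_sub_distrib, Finset.sum_const, Finset.card_range, nsmul_eq_mul]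
  congr 1
  ring

lemma antitone_excursionWeight {X : Type*} (C : X → ℝ) (α : ℝ) (xs : X) (ω : ℕ → X) :
    Antitone fun Λ => excursionWeight C α xs Λ ω := fun a b hab =>
  Real.exp_le_exp.2 (Finset.sum_le_sum fun _ _ => by linarith)

lemma excursionWeight_lt {X : Type*} (C : X → ℝ) (α : ℝ) {xs : X} {ω : ℕ → X}
    (hω : returnTime xs ω ≠ 0) {a b : ℝ} (hab : a < b) :
    excursionWeight C α xs b ω < excursionWeight C α xs a ω :=
  Real.exp_lt_exp.2 (Finset.sum_lt_sum_of_nonempty (Finset.nonempty_range_iff.2 hω)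
    fun _ _ => by linarith)

lemma continuous_excursionWeight {X : Type*} (C : X → ℝ) (α : ℝ) (xs : X) (ω : ℕ → X) :
    Continuous fun Λ => excursionWeight C α xs Λ ω := by
  unfold excursionWeight
  fun_prop

lemma abs_log_excursionWeight_le {X : Type*} {C : X → ℝ} {α K : ℝ} (hK : ∀ x, |α * C x| ≤ K)
    (xs : X) (Λ : ℝ) (ω : ℕ → X) :
    |Real.log (excursionWeight C α xs Λ ω)| ≤ returnTime xs ω * (K + |Λ|) := by
  rw [excursionWeight, Real.log_exp]
  refine (Finset.abs_sum_le_sum_abs _ _).trans ?_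
  refine (Finset.sum_le_card_nsmul _ _ (K + |Λ|) fun i _ => ?_).trans_eq
    (by rw [Finset.card_range, nsmul_eq_mul])
  exact (abs_sub _ _).trans (add_le_add_left (hK _) _)

lemma IsTruncation.measurable_comp {X : Type*} [Countable X] [MeasurableSpace X]
    [MeasurableSingletonClass X] {M : ℝ} {t : ℝ → ℝ} (ht : IsTruncation M t) (C : X → ℝ) (α : ℝ)
    (xs : X) (Λ : ℝ) : Measurable fun ω => t (excursionWeight C α xs Λ ω) := by
  have h : Measurable fun y : Set.Ioi (0 : ℝ) => t y :=
    (continuousOn_iff_continuous_domRestrict.1 ht.continuousOn).measurable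
  exact h.comp ((measurable_excursionWeight C α xs Λ).subtype_mk
    (h := fun ω => excursionWeight_pos C α xs Λ ω))

section Root

variable {X : Type*} [Fintype X] [DecidableEq X] [MeasurableSpace X] [MeasurableSingletonClass X]

/-- `E[t(H(Λ))]` for a truncation function `t`. -/
noncomputable def truncMean (P : rowStochastic ℝ X) (C : X → ℝ) (α : ℝ) (xs : X) (t : ℝ → ℝ)
    (Λ : ℝ) : ℝ≥0∞ :=
  ∫⁻ ω, ENNReal.ofReal (t (excursionWeight C α xs Λ ω)) ∂chainLaw P xs

variable {P : rowStochastic ℝ X} {C : X → ℝ} {α K : ℝ} {xs : X} {M : ℝ} {t : ℝ → ℝ}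

lemma antitone_truncMean (P : rowStochastic ℝ X) (C : X → ℝ) (α : ℝ) (xs : X)
    (ht : IsTruncation M t) : Antitone (truncMean P C α xs t) := fun a b hab =>
  lintegral_mono fun ω => ENNReal.ofReal_le_ofReal
    (ht.monotoneOn (excursionWeight_pos C α xs b ω) (excursionWeight_pos C α xs a ω)
      (antitone_excursionWeight C α xs ω hab))

lemma truncMean_lt_top (ht : IsTruncation M t) (hK : ∀ x, |α * C x| ≤ K)
    (hτ : ∀ᵐ ω ∂chainLaw P xs, returnTime xs ω ≠ 0)
    (hmom : ∫⁻ ω, ENNReal.ofReal ((returnTime xs ω : ℝ) ^ 4) ∂chainLaw P xs < ∞) (Λ : ℝ) :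
    truncMean P C α xs t Λ < ∞ := by
  obtain ⟨D, hD⟩ := ht.exists_le_pow_log
  have hK0 : 0 ≤ K := (abs_nonneg _).trans (hK xs)
  have hbound : ∀ᵐ ω ∂chainLaw P xs, ENNReal.ofReal (t (excursionWeight C α xs Λ ω)) ≤
      ENNReal.ofReal (|D| * (1 + (K + |Λ|)) ^ 4) * ENNReal.ofReal ((returnTime xs ω : ℝ) ^ 4) := by
    filter_upwards [hτ] with ω hω
    rw [← ENNReal.ofReal_mul (by positivity)]
    refine ENNReal.ofReal_le_ofReal ((hD _ (excursionWeight_pos C α xs Λ ω)).trans ?_)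
    rw [mul_assoc, ← mul_pow]
    refine mul_le_mul (le_abs_self D) ?_ (by positivity) (abs_nonneg D)
    have h1 := abs_log_excursionWeight_le hK xs Λ ω
    have h2 : (1 : ℝ) ≤ returnTime xs ω := by exact_mod_cast Nat.one_le_iff_ne_zero.2 hω
    gcongr
    linarith
  refine (lintegral_mono_ae hbound).trans_lt ?_
  rw [lintegral_const_mul' _ _ ENNReal.ofReal_ne_top]
  exact ENNReal.mul_lt_top ENNReal.ofReal_lt_top hmom

lemma continuous_truncMean (ht : IsTruncation M t)
    (hfin : ∀ Λ, truncMean P C α xs t Λ < ∞) : Continuous (truncMean P C α xs t) := by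
  refine continuous_iff_continuousAt.2 fun Λ => ?_
  refine tendsto_lintegral_filter_of_dominated_convergence
    (fun ω => ENNReal.ofReal (t (excursionWeight C α xs (Λ - 1) ω))) ?_ ?_ (hfin (Λ - 1)).ne ?_
  · exact Eventually.of_forall fun Λ' => (ht.measurable_comp C α xs Λ').ennreal_ofReal
  · filter_upwards [eventually_gt_nhds (sub_one_lt Λ)] with Λ' hΛ'
    exact Eventually.of_forall fun ω => ENNReal.ofReal_le_ofReal
      (ht.monotoneOn (excursionWeight_pos C α xs Λ' ω) (excursionWeight_pos C α xs _ ω)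
        (antitone_excursionWeight C α xs ω hΛ'.le))
  · refine Eventually.of_forall fun ω => ENNReal.tendsto_ofReal ?_
    have hpos := excursionWeight_pos C α xs Λ ω
    exact ((ht.continuousOn.continuousAt (Ioi_mem_nhds hpos)).tendsto).comp
      (continuous_excursionWeight C α xs ω).continuousAt

/-- `E[t(H(Λ))]` decreases strictly where it does not exceed `1`: since `t` is the identity below
the level `M`, equality of two values forces `H ≥ M` almost surely. -/
lemma truncMean_injOn (ht : IsTruncation M t) (hM : 1 < M)
    (hτ : ∀ᵐ ω ∂chainLaw P xs, returnTime xs ω ≠ 0) {a b : ℝ}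
    (ha : truncMean P C α xs t a = 1) (hb : truncMean P C α xs t b = 1) : a = b := by
  wlog hab : a < b generalizing a b
  · rcases lt_trichotomy a b with h | h | h
    exacts [absurd h hab, h, (this hb ha h).symm]
  exfalso
  have hM0 : 0 < M := zero_lt_one.trans hM
  have hle : (fun ω => ENNReal.ofReal (t (excursionWeight C α xs b ω))) ≤ᵐ[chainLaw P xs]
      fun ω => ENNReal.ofReal (t (excursionWeight C α xs a ω)) :=
    Eventually.of_forall fun ω => ENNReal.ofReal_le_ofReal
      (ht.monotoneOn (excursionWeight_pos C α xs b ω) (excursionWeight_pos C α xs a ω)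
        (antitone_excursionWeight C α xs ω hab.le))
  have heq := ae_eq_of_ae_le_of_lintegral_le hle (hb.trans_ne ENNReal.one_ne_top)
    (ht.measurable_comp C α xs a).ennreal_ofReal.aemeasurable (ha.trans hb.symm).le
  have hlarge : ∀ᵐ ω ∂chainLaw P xs,
      ENNReal.ofReal M ≤ ENNReal.ofReal (t (excursionWeight C α xs b ω)) := by
    filter_upwards [heq, hτ] with ω hω hτω
    have hposa := excursionWeight_pos C α xs a ω
    have hposb := excursionWeight_pos C α xs b ω
    have hlt := excursionWeight_lt C α hτω hab
    rw [ENNReal.ofReal_eq_ofReal_iff (ht.nonneg hM0 hposb) (ht.nonneg hM0 hposa)] at hω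
    refine ENNReal.ofReal_le_ofReal ?_
    by_contra! hcon
    have h1 : min (excursionWeight C α xs a ω) M ≤ t (excursionWeight C α xs b ω) :=
      (ht.min_le _ hposa).trans_eq hω.symm
    rcases min_le_iff.1 h1 with h | h
    · linarith [ht.le_self _ hposb]
    · linarith
  have : ENNReal.ofReal M ≤ 1 := by
    rw [← hb]
    simpa [truncMean] using lintegral_mono_ae hlarge
  rw [ENNReal.ofReal_le_one] at this
  linarith

/-- For very negative `Λ` already the first factor of `H(Λ)` is at least `M`. -/
lemma le_truncMean_of_le (ht : IsTruncation M t) (hM : 1 < M) (hK : ∀ x, |α * C x| ≤ K)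
    (hτ : ∀ᵐ ω ∂chainLaw P xs, returnTime xs ω ≠ 0) {Λ : ℝ} (hΛ : Λ ≤ -K - Real.log M) :
    ENNReal.ofReal M ≤ truncMean P C α xs t Λ := by
  have hM0 : 0 < M := zero_lt_one.trans hM
  have hlog : 0 ≤ Real.log M := Real.log_nonneg hM.le
  have : ∀ᵐ ω ∂chainLaw P xs,
      ENNReal.ofReal M ≤ ENNReal.ofReal (t (excursionWeight C α xs Λ ω)) := by
    filter_upwards [hτ] with ω hω
    refine ENNReal.ofReal_le_ofReal
      (le_trans (le_min ?_ le_rfl) (ht.min_le _ (excursionWeight_pos C α xs Λ ω)))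
    rw [excursionWeight, ← Real.log_le_iff_le_exp hM0]
    have hterm : ∀ i, Real.log M ≤ α * C (ω i) - Λ := fun i => by
      linarith [(abs_le.1 (hK (ω i))).1]
    calc Real.log M ≤ α * C (ω 0) - Λ := hterm 0
      _ ≤ ∑ i ∈ Finset.range (returnTime xs ω), (α * C (ω i) - Λ) :=
        Finset.single_le_sum (f := fun i => α * C (ω i) - Λ) (fun i _ => hlog.trans (hterm i))
          (Finset.mem_range.2 (Nat.pos_of_ne_zero hω))
  simpa [truncMean] using lintegral_mono_ae this

/-- The truncated equation `E[t(H(Λ))] = 1` has exactly one root, and it is at most the root `Λ₀`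
of the untruncated equation. -/
theorem existsUnique_truncMean_eq_one (ht : IsTruncation M t) (hM : 1 < M)
    (hK : ∀ x, |α * C x| ≤ K) (hτ : ∀ᵐ ω ∂chainLaw P xs, returnTime xs ω ≠ 0)
    (hmom : ∫⁻ ω, ENNReal.ofReal ((returnTime xs ω : ℝ) ^ 4) ∂chainLaw P xs < ∞) {Λ₀ : ℝ}
    (hΛ₀ : |Λ₀| ≤ K)
    (hroot : ∫⁻ ω, ENNReal.ofReal (excursionWeight C α xs Λ₀ ω) ∂chainLaw P xs = 1) :
    ∃ Λ ≤ Λ₀, ∀ Λ', truncMean P C α xs t Λ' = 1 ↔ Λ' = Λ := by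
  have hlog : 0 ≤ Real.log M := Real.log_nonneg hM.le
  have hlow := le_truncMean_of_le ht hM hK hτ le_rfl
  have hup : truncMean P C α xs t Λ₀ ≤ 1 := by
    rw [← hroot]
    exact lintegral_mono fun ω => ENNReal.ofReal_le_ofReal
      (ht.le_self _ (excursionWeight_pos C α xs Λ₀ ω))
  have hM1 : 1 ≤ ENNReal.ofReal M := ENNReal.one_le_ofReal.2 hM.le
  have hcont := continuous_truncMean ht (truncMean_lt_top ht hK hτ hmom)
  obtain ⟨Λ, hmem, hΛ⟩ := intermediate_value_Icc'
    (show -K - Real.log M ≤ Λ₀ by linarith [(abs_le.1 hΛ₀).1]) hcont.continuousOn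
    ⟨hup, hM1.trans hlow⟩
  exact ⟨Λ, hmem.2, fun Λ' => ⟨fun h => truncMean_injOn ht hM hτ h hΛ, fun h => h ▸ hΛ⟩⟩

/-- The excursions of length at most `n` carry the mass `1 - w n` of `H(Λ₀)`, where `w n` is the
proportion of `v`-mass that has not returned by time `n`; lowering `Λ₀` by `δ` multiplies `H` by at
least `exp δ`, and for large `M` the truncation does not affect these excursions. -/
lemma one_lt_truncMean_sub (ht : IsTruncation M t) {Λ₀ δ : ℝ} (hδ : 0 < δ)
    (hK : ∀ x, |α * C x| ≤ K) (hΛ₀ : |Λ₀| ≤ K) (hτ : ∀ᵐ ω ∂chainLaw P xs, returnTime xs ω ≠ 0)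
    {v : X → ℝ} (hv : ∀ x, 0 < v x) (h : tilted (P : Matrix X X ℝ) C α Λ₀ *ᵥ v = v) {n : ℕ}
    (hn : 1 < Real.exp δ *
      (1 - (taboo (tilted (P : Matrix X X ℝ) C α Λ₀) xs ^ n *ᵥ v) xs / v xs))
    (hM : Real.exp (n * (2 * K + δ)) ≤ M) :
    1 < truncMean P C α xs t (Λ₀ - δ) := by
  have hA := tilted_nonneg P.2.1 C α Λ₀
  set w : ℕ → ℝ := fun n => (taboo (tilted (P : Matrix X X ℝ) C α Λ₀) xs ^ n *ᵥ v) xs / v xs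
    with hw
  have hanti : Antitone w := antitone_taboo_div hA hv h xs
  have hK0 : 0 ≤ K := (abs_nonneg _).trans (hK xs)
  have hterm : ∀ k ∈ Finset.range n, ENNReal.ofReal (Real.exp δ * (w k - w (k + 1))) ≤
      ∫⁻ ω in {ω | returnTime xs ω = k + 1},
        ENNReal.ofReal (t (excursionWeight C α xs (Λ₀ - δ) ω)) ∂chainLaw P xs := by
    intro k hk
    rw [ENNReal.ofReal_mul (Real.exp_pos δ).le,
      ← setLIntegral_excursionWeight_eq_sub P xs hv h k,
      ← lintegral_const_mul' _ _ ENNReal.ofReal_ne_top]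
    refine setLIntegral_mono' (measurable_returnTime xs (measurableSet_singleton (k + 1)))
      fun ω hω => ?_
    have hω : returnTime xs ω = k + 1 := hω
    have hkn : ((k + 1 : ℕ) : ℝ) ≤ n := by exact_mod_cast Finset.mem_range.1 hk
    have hk1 : (1 : ℝ) ≤ (k + 1 : ℕ) := by exact_mod_cast Nat.le_add_left 1 k
    rw [← ENNReal.ofReal_mul (Real.exp_pos δ).le]
    refine ENNReal.ofReal_le_ofReal (le_trans (le_min ?_ (le_trans ?_ hM))
      (ht.min_le _ (excursionWeight_pos C α xs (Λ₀ - δ) ω)))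
    · rw [excursionWeight_sub, hω]
      refine mul_le_mul_of_nonneg_right (Real.exp_le_exp.2 ?_) (excursionWeight_pos ..).le
      exact le_mul_of_one_le_left hδ.le hk1
    · have h1 := (abs_le.1 (abs_log_excursionWeight_le hK xs Λ₀ ω)).2
      rw [hω] at h1
      rw [← Real.exp_log (excursionWeight_pos C α xs Λ₀ ω), ← Real.exp_add]
      refine Real.exp_le_exp.2 ?_
      nlinarith
  have hsum : ENNReal.ofReal (Real.exp δ * (1 - w n)) ≤ truncMean P C α xs t (Λ₀ - δ) := by
    rw [truncMean, lintegral_eq_tsum_returnTime P xs xs hτ]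
    refine le_trans ?_ (ENNReal.sum_le_tsum (Finset.range n))
    refine le_trans ?_ (Finset.sum_le_sum hterm)
    rw [← ENNReal.ofReal_sum_of_nonneg fun k _ =>
      mul_nonneg (Real.exp_pos δ).le (sub_nonneg.2 (hanti k.le_succ)), ← Finset.mul_sum,
      Finset.sum_range_sub']
    simp [hw, div_self (hv xs).ne']
  exact (ENNReal.one_lt_ofReal.2 hn).trans_le hsum

end Root

/-! ### Uniform approximation over the parameter -/

section Main

variable {X : Type*} [Fintype X] [DecidableEq X] [MeasurableSpace X] [MeasurableSingletonClass X]

/-- What holds for a single chain, with bounds that depend on it only through `K`, `N` and `ε`. -/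
theorem exists_exponent_and_truncation_bounds (P : rowStochastic ℝ X) {C : X → ℝ} {α K : ℝ}
    (xs : X) (hK : ∀ x, |α * C x| ≤ K) {N : ℕ} {ε : ℝ} (hε : 0 < ε)
    (hN : ∀ x y, ∃ k ∈ Finset.Icc 1 N, ε ≤ ((P : Matrix X X ℝ) ^ k) x y) {η : ℝ}
    (hη : η = (Real.exp (-(2 * K)) ^ N * ε) ^ 2) :
    ∃ Λ₀ : ℝ, (∀ x, Tendsto (finiteHorizonCost P C α x) atTop (𝓝 Λ₀)) ∧ η ≤ 1 ∧
      (∀ M t, 1 < M → IsTruncation M t →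
        ∃ Λ ≤ Λ₀, ∀ Λ', truncMean P C α xs t Λ' = 1 ↔ Λ' = Λ) ∧
      ∀ (δ : ℝ) (m : ℕ), 0 < δ → 1 < Real.exp δ * (1 - (1 - η) ^ m) →
        ∀ M t, Real.exp ((N * m : ℕ) * (2 * K + δ)) ≤ M → IsTruncation M t →
          1 < truncMean P C α xs t (Λ₀ - δ) := by
  obtain ⟨Λ₀, v, hΛ₀, hv, hfix, hhit, hlim⟩ := exists_perron_exponent P xs hK hε hN
  rw [← hη] at hhit
  have hη0 : 0 < η := by rw [hη]; positivity
  have hτ := ae_returnTime_ne_zero P xs hε hN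
  have hmom := lintegral_returnTime_pow_lt_top P xs hε hN
  obtain ⟨hη1, htail, -⟩ := exists_taboo_div_le_geometric
    (tilted_nonneg P.2.1 C α Λ₀) hv hfix xs hη0 hhit
  have hroot : ∫⁻ ω, ENNReal.ofReal (excursionWeight C α xs Λ₀ ω) ∂chainLaw P xs = 1 := by
    rw [lintegral_eq_tsum_returnTime P xs xs hτ,
      tsum_setLIntegral_excursionWeight P xs hv hfix hη0 hhit]
  refine ⟨Λ₀, hlim, hη1, fun M t hM ht =>
    existsUnique_truncMean_eq_one ht hM hK hτ hmom hΛ₀ hroot, fun δ m hδ hm M t hM ht => ?_⟩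
  refine one_lt_truncMean_sub ht hδ hK hΛ₀ hτ hv hfix (n := N * m) (hm.trans_le ?_) hM
  exact mul_le_mul_of_nonneg_left (by linarith [htail m]) (Real.exp_pos δ).le

end Main

end RiskSensitive

open RiskSensitive in
theorem mainTheorem3 {X : Type*} [Fintype X] [DecidableEq X] [MeasurableSpace X]
    [MeasurableSingletonClass X] {l : ℕ}
    (P : EuclideanSpace ℝ (Fin l) → rowStochastic ℝ X)
    (C : EuclideanSpace ℝ (Fin l) → X → ℝ)
    (α : ℝ) (hα : 0 < α) (xs : X)
    (hP : ∀ Q ∈ closure (Set.range fun θ => (P θ : Matrix X X ℝ)),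
      Q.IsIrreducible ∧ RiskSensitive.IsAperiodic Q)
    (hPdiff : ∀ x y, RiskSensitive.IsBoundedTwiceDiff fun θ => (P θ : Matrix X X ℝ) x y)
    (hCdiff : ∀ x, RiskSensitive.IsBoundedTwiceDiff fun θ => C θ x) :
    -- the limit defining `Λ_θ` exists and does not depend on the initial state
    (∀ θ x, Tendsto (RiskSensitive.finiteHorizonCost (P θ) (C θ) α x) atTop
      (𝓝 (RiskSensitive.riskCost (P θ) (C θ) α xs))) ∧
    -- hard truncation: `Λ_θ^{(M)}` is the unique root, and approximates `Λ_θ` uniformly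
    (∀ M : ℝ, 1 < M → ∀ θ, ∀ Λ : ℝ, RiskSensitive.gHard (P θ) (C θ) α xs M Λ = 1 ↔
      Λ = RiskSensitive.hardCost (P θ) (C θ) α xs M) ∧
    (∀ δ : ℝ, 0 < δ → ∃ Mδ : ℝ, 1 < Mδ ∧ ∀ M : ℝ, Mδ ≤ M → ∀ θ,
      0 ≤ RiskSensitive.riskCost (P θ) (C θ) α xs - RiskSensitive.hardCost (P θ) (C θ) α xs M ∧
      RiskSensitive.riskCost (P θ) (C θ) α xs - RiskSensitive.hardCost (P θ) (C θ) α xs M < δ) ∧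
    -- smooth truncation: `Λ_θ^{(M)}` is the unique root, and increases to `Λ_θ` uniformly
    (∀ M : ℝ, 1 < M → ∀ θ, ∀ Λ : ℝ, RiskSensitive.gSmooth (P θ) (C θ) α xs M Λ = 1 ↔
      Λ = RiskSensitive.smoothCost (P θ) (C θ) α xs M) ∧
    (∀ θ, MonotoneOn (fun M => RiskSensitive.smoothCost (P θ) (C θ) α xs M) (Set.Ioi 1)) ∧
    (∀ M : ℝ, 1 < M → ∀ θ, RiskSensitive.smoothCost (P θ) (C θ) α xs M ≤
      RiskSensitive.riskCost (P θ) (C θ) α xs) ∧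
    TendstoUniformly (fun (M : ℝ) θ => RiskSensitive.smoothCost (P θ) (C θ) α xs M)
      (fun θ => RiskSensitive.riskCost (P θ) (C θ) α xs) atTop := by
  -- the closure of the family of transition matrices is compact
  have hcompact : IsCompact (closure (Set.range fun θ => (P θ : Matrix X X ℝ))) := by
    have hbox : IsCompact (Set.univ.pi fun _ : X => Set.univ.pi fun _ : X => Set.Icc (0 : ℝ) 1) :=
      isCompact_univ_pi fun _ => isCompact_univ_pi fun _ => isCompact_Icc
    refine hbox.of_isClosed_subset isClosed_closure (closure_minimal ?_ hbox.isClosed)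
    rintro _ ⟨θ, rfl⟩ x - y -
    refine ⟨(P θ).2.1 x y, ?_⟩
    rw [← sum_row_of_mem_rowStochastic (P θ).2 x]
    exact Finset.single_le_sum (fun z _ => (P θ).2.1 x z) (Finset.mem_univ y)
  obtain ⟨N, ε, hε, hN⟩ := exists_uniform_pow_le hcompact fun Q hQ => (hP Q hQ).1
  have hNθ := fun θ => hN _ (subset_closure (Set.mem_range_self θ))
  obtain ⟨K, hK⟩ : ∃ K, ∀ θ x, |α * C θ x| ≤ K := by
    choose B hB using fun x => (hCdiff x).2.2.1
    have : Nonempty X := ⟨xs⟩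
    obtain ⟨b, hb⟩ := Finite.exists_max B
    refine ⟨α * B b, fun θ x => ?_⟩
    rw [abs_mul, abs_of_pos hα]
    exact mul_le_mul_of_nonneg_left ((hB x θ).trans (hb x)) hα.le
  obtain ⟨η, hη⟩ : ∃ η, η = (Real.exp (-(2 * K)) ^ N * ε) ^ 2 := ⟨_, rfl⟩
  have hη0 : 0 < η := by rw [hη]; positivity
  choose Λ₀ hlim hη1 hroot hlow using fun θ =>
    exists_exponent_and_truncation_bounds (P θ) xs (hK θ) hε (hNθ θ) hη
  have hrisk : ∀ θ, riskCost (P θ) (C θ) α xs = Λ₀ θ := fun θ => (hlim θ xs).limUnder_eq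
  have hhard : ∀ M, 1 < M → ∀ θ, hardCost (P θ) (C θ) α xs M ≤ Λ₀ θ ∧
      ∀ Λ, gHard (P θ) (C θ) α xs M Λ = 1 ↔ Λ = hardCost (P θ) (C θ) α xs M := fun M hM θ => by
    obtain ⟨Λ, hle, hiff⟩ := hroot θ M _ hM (isTruncation_min (zero_lt_one.trans hM))
    have hiff : ∀ Λ', gHard (P θ) (C θ) α xs M Λ' = 1 ↔ Λ' = Λ := hiff
    have heq : hardCost (P θ) (C θ) α xs M = Λ :=
      (hiff _).1 (Classical.epsilon_spec (p := fun Λ' => gHard (P θ) (C θ) α xs M Λ' = 1)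
        ⟨Λ, (hiff Λ).2 rfl⟩)
    rw [heq]
    exact ⟨hle, hiff⟩
  have hsmooth : ∀ M, 1 < M → ∀ θ, smoothCost (P θ) (C θ) α xs M ≤ Λ₀ θ ∧
      ∀ Λ, gSmooth (P θ) (C θ) α xs M Λ = 1 ↔ Λ = smoothCost (P θ) (C θ) α xs M := fun M hM θ => by
    obtain ⟨Λ, hle, hiff⟩ := hroot θ M _ hM (isTruncation_smoothTrunc (zero_lt_one.trans hM))
    have hiff : ∀ Λ', gSmooth (P θ) (C θ) α xs M Λ' = 1 ↔ Λ' = Λ := hiff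
    have heq : smoothCost (P θ) (C θ) α xs M = Λ :=
      (hiff _).1 (Classical.epsilon_spec (p := fun Λ' => gSmooth (P θ) (C θ) α xs M Λ' = 1)
        ⟨Λ, (hiff Λ).2 rfl⟩)
    rw [heq]
    exact ⟨hle, hiff⟩
  -- the level beyond which every truncated root lies within `δ` of `Λ₀ θ`
  have hunif : ∀ δ : ℝ, 0 < δ → ∃ Mδ : ℝ, 1 < Mδ ∧ ∀ M, Mδ ≤ M → ∀ t, IsTruncation M t →
      ∀ θ Λ, truncMean (P θ) (C θ) α xs t Λ = 1 → Λ₀ θ - Λ < δ := by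
    intro δ hδ
    obtain ⟨m, hm⟩ : ∃ m : ℕ, 1 < Real.exp δ * (1 - (1 - η) ^ m) := by
      have h1 : Tendsto (fun m : ℕ => Real.exp δ * (1 - (1 - η) ^ m)) atTop
          (𝓝 (Real.exp δ * (1 - 0))) :=
        ((tendsto_pow_atTop_nhds_zero_of_lt_one (by linarith [hη1 0])
          (by linarith)).const_sub 1).const_mul _
      rw [sub_zero, mul_one] at h1
      exact (h1.eventually_const_lt (Real.one_lt_exp_iff.2 hδ)).exists
    refine ⟨max 2 (Real.exp ((N * m : ℕ) * (2 * K + δ))), lt_max_of_lt_left one_lt_two,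
      fun M hM t ht θ Λ hΛ => ?_⟩
    have h1 := hlow θ δ m hδ hm M t ((le_max_right _ _).trans hM) ht
    by_contra! hcon
    have h2 := antitone_truncMean (P θ) (C θ) α xs ht (show Λ ≤ Λ₀ θ - δ by linarith)
    rw [hΛ] at h2
    exact h2.not_gt h1
  refine ⟨fun θ x => hrisk θ ▸ hlim θ x, fun M hM θ => (hhard M hM θ).2, fun δ hδ => ?_,
    fun M hM θ => (hsmooth M hM θ).2, fun θ M₁ hM₁ M₂ hM₂ hM => ?_,
    fun M hM θ => hrisk θ ▸ (hsmooth M hM θ).1, ?_⟩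
  · obtain ⟨Mδ, hMδ, hclose⟩ := hunif δ hδ
    refine ⟨Mδ, hMδ, fun M hM θ => ?_⟩
    have hM1 := hMδ.trans_le hM
    rw [hrisk]
    exact ⟨sub_nonneg.2 (hhard M hM1 θ).1,
      hclose M hM _ (isTruncation_min (zero_lt_one.trans hM1)) θ _ (((hhard M hM1 θ).2 _).2 rfl)⟩
  · have hM₁0 : (0 : ℝ) < M₁ := zero_lt_one.trans hM₁
    have hroot₁ := ((hsmooth M₁ hM₁ θ).2 _).2 rfl
    have hroot₂ := ((hsmooth M₂ hM₂ θ).2 _).2 rfl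
    change smoothCost (P θ) (C θ) α xs M₁ ≤ smoothCost (P θ) (C θ) α xs M₂
    by_contra! hlt
    have h1 : gSmooth (P θ) (C θ) α xs M₁ (smoothCost (P θ) (C θ) α xs M₁) ≤
        gSmooth (P θ) (C θ) α xs M₂ (smoothCost (P θ) (C θ) α xs M₁) :=
      lintegral_mono fun ω => ENNReal.ofReal_le_ofReal
        (smoothTrunc_mono_level hM₁0 hM (excursionWeight_pos ..))
    have h2 : gSmooth (P θ) (C θ) α xs M₂ (smoothCost (P θ) (C θ) α xs M₁) ≤
        gSmooth (P θ) (C θ) α xs M₂ (smoothCost (P θ) (C θ) α xs M₂) :=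
      antitone_truncMean (P θ) (C θ) α xs (isTruncation_smoothTrunc (zero_lt_one.trans hM₂)) hlt.le
    rw [hroot₁] at h1
    rw [hroot₂] at h2
    exact hlt.ne' (((hsmooth M₂ hM₂ θ).2 _).1 (le_antisymm h2 h1))
  · rw [Metric.tendstoUniformly_iff]
    intro δ hδ
    obtain ⟨Mδ, hMδ, hclose⟩ := hunif δ hδ
    filter_upwards [eventually_ge_atTop Mδ] with M hM θ
    have hM1 := hMδ.trans_le hM
    rw [hrisk, Real.dist_eq, abs_of_nonneg (sub_nonneg.2 (hsmooth M hM1 θ).1)]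
    exact hclose M hM _ (isTruncation_smoothTrunc (zero_lt_one.trans hM1)) θ _
      (((hsmooth M hM1 θ).2 _).2 rfl)
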